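/- Let $\mathbb F$ be $\mathbb R$ or $\mathbb C$. A left-symmetric algebra is a finite dimensional algebra $\mathfrak g$ over $\mathbb F$ whose associator $(x,y,z)=x(yz)-(xy)z$ satisfies $(x,y,z)=(y,x,z)$. Then $[x,y]=xy-yx$ makes $\mathfrak g$ a Lie algebra and $L(x)y=xy$ defines a representation $L$ of this Lie algebra on $\mathfrak g$. Let $G$ be the group of affine transformations of $\mathfrak g$ generated by the exponentials (time-one maps) of the affine vector fields $F_x(y)=xy+x$, $x\in\mathfrak g$; the algebra $\mathfrak g$ is called complete if $G$ acts transitively on $\mathfrak g$. Let $\mathfrak h$ be a Cartan subalgebra of the Lie algebra $\mathfrak g$. For a representation $\rho$ of $\mathfrak h$ on a complex vector space $V$ and a linear functional $\lambda$ on $\mathfrak h$, the root subspace of $\lambda$ is $\{v\in V:\ \forall x\in\mathfrak h\ \exists n\ (\rho(x)-\lambda(x))^n v=0\}$. If $\mathbb F=\mathbb C$, let $\mathfrak h^\lambda$ and $\mathfrak g^\lambda$ be the root subspaces of $\lambda\in\mathfrak h^*$ in $\mathfrak g$ for the restrictions to $\mathfrak h$ of $\mathrm{ad}$ and $L$, respectively.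 If $\mathbb F=\mathbb R$, then $\lambda$ is a complex linear functional on $\mathfrak h\otimes\mathbb C$, and $\mathfrak h^\lambda$, $\mathfrak g^\lambda\subseteq\mathfrak g$ are the real parts (the images under $\mathrm{Re}:\mathfrak g\otimes\mathbb C\to\mathfrak g$) of the root subspaces of $\lambda$ in $\mathfrak g\otimes\mathbb C$ for the complexified representations of $\mathfrak h\otimes\mathbb C$. The Cartan subalgebra $\mathfrak h$ is called canonical if $\mathfrak h^\lambda=\mathfrak g^\lambda$ for all $\lambda$. Theorem. Let $\mathfrak g$ be a complete left-symmetric algebra, real or complex. Then $\mathfrak g$ has exactly one canonical Cartan subalgebra $\mathfrak h$. For this $\mathfrak h$, the space $\mathfrak g$ is the direct sum of the distinct nonzero subspaces among the $\mathfrak g^\lambda=\mathfrak h^\lambda$ (the canonical decomposition), and for every $x\in\mathfrak h$ the operators $L(x)$ and $\mathrm{ad}(x)$ on $\mathfrak g$ have the same semisimple part in their additive Jordan decompositions. -/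

import Mathlib

open scoped TensorProduct

namespace LeftSymmetric

/-! A left-symmetric algebra is Mathlib's `LeftPreLieRing` / `LeftPreLieAlgebra`; its underlying
Lie algebra is Mathlib's instance, with bracket `⁅x, y⁆ = x * y - y * x`. -/

section Exponential

variable {𝕜 V : Type*} [RCLike 𝕜] [AddCommGroup V] [Module 𝕜 V] [FiniteDimensional 𝕜 V]

/-- The exponential of an endomorphism of a finite dimensional space, computed in a basis
(see `linExp_eq` for the independence of the basis). -/
noncomputable def linExp (A : Module.End 𝕜 V) : Module.End 𝕜 V :=
  Matrix.toLin (Module.finBasis 𝕜 V) (Module.finBasis 𝕜 V)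
    (NormedSpace.exp (LinearMap.toMatrix (Module.finBasis 𝕜 V) (Module.finBasis 𝕜 V) A))

theorem map_exp_algEquiv {A B : Type*} [NormedRing A] [NormedAlgebra 𝕜 A] [FiniteDimensional 𝕜 A]
    [NormedRing B] [NormedAlgebra 𝕜 B] (f : A ≃ₐ[𝕜] B) (a : A) :
    f (NormedSpace.exp a) = NormedSpace.exp (f a) := by
  let _ : NormedAlgebra ℚ A := NormedAlgebra.restrictScalars ℚ 𝕜 A
  let _ : NormedAlgebra ℚ B := NormedAlgebra.restrictScalars ℚ 𝕜 B
  have hcomp : CompleteSpace A := FiniteDimensional.complete 𝕜 A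
  exact NormedSpace.map_exp f f.toLinearMap.continuous_of_finiteDimensional a

theorem linExp_eq {n : Type*} [Fintype n] [DecidableEq n] (b : Module.Basis n 𝕜 V)
    (A : Module.End 𝕜 V) :
    linExp A = Matrix.toLin b b (NormedSpace.exp (LinearMap.toMatrix b b A)) := by
  let c := Module.finBasis 𝕜 V
  let f : Matrix n n 𝕜 ≃ₐ[𝕜] Matrix (Fin (Module.finrank 𝕜 V)) (Fin (Module.finrank 𝕜 V)) 𝕜 :=
    (LinearMap.toMatrixAlgEquiv b).symm.trans (LinearMap.toMatrixAlgEquiv c)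
  have h : f (NormedSpace.exp (LinearMap.toMatrix b b A))
      = NormedSpace.exp (f (LinearMap.toMatrix b b A)) := by
    let _ : NormedRing (Matrix n n 𝕜) := Matrix.linftyOpNormedRing
    let _ : NormedAlgebra 𝕜 (Matrix n n 𝕜) := Matrix.linftyOpNormedAlgebra
    let _ : NormedRing (Matrix (Fin (Module.finrank 𝕜 V)) (Fin (Module.finrank 𝕜 V)) 𝕜) :=
      Matrix.linftyOpNormedRing
    let _ : NormedAlgebra 𝕜 (Matrix (Fin (Module.finrank 𝕜 V)) (Fin (Module.finrank 𝕜 V)) 𝕜) :=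
      Matrix.linftyOpNormedAlgebra
    exact map_exp_algEquiv f _
  have h1 : f (LinearMap.toMatrix b b A) = LinearMap.toMatrix c c A := by
    change LinearMap.toMatrix c c (Matrix.toLin b b (LinearMap.toMatrix b b A)) = _
    rw [Matrix.toLin_toMatrix]
  rw [h1] at h
  change Matrix.toLin c c (NormedSpace.exp (LinearMap.toMatrix c c A)) = _
  rw [← h]
  change Matrix.toLin c c (LinearMap.toMatrix c c (Matrix.toLin b b _)) = _
  rw [Matrix.toLin_toMatrix]

end Exponential

section Completeness

variable (𝕜 : Type*) {𝔤 : Type*} [RCLike 𝕜] [LeftPreLieRing 𝔤] [LeftPreLieAlgebra 𝕜 𝔤]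

/-- The affine vector field `F_x(y) = x * y + x` on `𝔤`, extended to the linear vector field
`(t, y) ↦ (0, x * y + t • x)` on `𝕜 × 𝔤`; the space `𝔤` is identified with the affine
hyperplane `t = 1`, to which this field is tangent. -/
noncomputable def affineField (x : 𝔤) : Module.End 𝕜 (𝕜 × 𝔤) :=
  (0 : 𝕜 × 𝔤 →ₗ[𝕜] 𝕜).prod
    ((LinearMap.mul 𝕜 𝔤 x).comp (LinearMap.snd 𝕜 𝕜 𝔤)
      + (LinearMap.fst 𝕜 𝕜 𝔤).smulRight x)

theorem affineField_apply (x y : 𝔤) (t : 𝕜) :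
    affineField 𝕜 x (t, y) = (0, x * y + t • x) := rfl

variable (𝔤) in
/-- The group `G` of affine transformations of `𝔤` generated by the exponentials (time-one maps)
of the vector fields `F_x(y) = x * y + x`, `x ∈ 𝔤`. It is the image of the simply connected Lie
group of `𝔤` under its affine action on `𝔤`. -/
noncomputable def affineGroup [FiniteDimensional 𝕜 𝔤] : Subgroup (𝔤 ≃ᵃ[𝕜] 𝔤) :=
  Subgroup.closure {φ | ∃ x : 𝔤, ∀ y : 𝔤, linExp (affineField 𝕜 x) (1, y) = (1, φ y)}

variable (𝔤) in
/-- A left-symmetric algebra is complete if its affine action is transitive. -/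
def IsComplete [FiniteDimensional 𝕜 𝔤] : Prop :=
  ∀ y z : 𝔤, ∃ φ ∈ affineGroup 𝕜 𝔤, φ y = z

end Completeness

section RootSpaces

/-- The root subspace `{v | ∀ x, ∃ n, (ρ(x) - χ(x))ⁿ v = 0}` of the linear functional `χ`. -/
def rootSpace {K H V : Type*} [Field K] [AddCommGroup H] [Module K H] [AddCommGroup V]
    [Module K V] (ρ : H →ₗ[K] Module.End K V) (χ : Module.Dual K H) : Submodule K V :=
  ⨅ x : H, (ρ x).maxGenEigenspace (χ x)

variable {H V : Type*} [AddCommGroup H] [Module ℝ H] [AddCommGroup V] [Module ℝ V]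

/-- The complexification `ℂ ⊗ H → End (ℂ ⊗ V)` of a real representation `H → End V`. -/
noncomputable def complexify (ρ : H →ₗ[ℝ] Module.End ℝ V) :
    (ℂ ⊗[ℝ] H) →ₗ[ℂ] Module.End ℂ (ℂ ⊗[ℝ] V) :=
  LinearMap.liftBaseChange ℂ ((LinearMap.baseChangeHom ℝ ℂ V V).comp ρ)

variable (V) in
/-- The real part `ℂ ⊗ V → V`, `z ⊗ v ↦ (Re z) • v`. -/
noncomputable def realPartMap : (ℂ ⊗[ℝ] V) →ₗ[ℝ] V :=
  (TensorProduct.lid ℝ V).toLinearMap.comp (LinearMap.rTensor V Complex.reLm)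

/-- The real part of the root subspace of a complex linear functional `χ` on `ℂ ⊗ H`. -/
noncomputable def realRootSpace (ρ : H →ₗ[ℝ] Module.End ℝ V) (χ : Module.Dual ℂ (ℂ ⊗[ℝ] H)) :
    Submodule ℝ V :=
  ((rootSpace (complexify ρ) χ).restrictScalars ℝ).map (realPartMap V)

end RootSpaces

section Canonical

variable {K 𝔤 : Type*} [Field K] [LeftPreLieRing 𝔤] [LeftPreLieAlgebra K 𝔤]

/-- The restriction to `𝔥` of the adjoint representation of `𝔤`. -/
def adRep (𝔥 : LieSubalgebra K 𝔤) : 𝔥 →ₗ[K] Module.End K 𝔤 :=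
  (LieAlgebra.ad K 𝔤 : 𝔤 →ₗ[K] Module.End K 𝔤).comp 𝔥.toSubmodule.subtype

/-- The restriction to `𝔥` of the representation of `𝔤` by left multiplications. -/
def leftRep (𝔥 : LieSubalgebra K 𝔤) : 𝔥 →ₗ[K] Module.End K 𝔤 :=
  (LinearMap.mul K 𝔤).comp 𝔥.toSubmodule.subtype

/-- The complex case: the root subspaces of `ad` and `L` with respect to the Cartan subalgebra
`𝔥` coincide. -/
def IsCanonicalComplex {𝔤 : Type*} [LeftPreLieRing 𝔤] [LeftPreLieAlgebra ℂ 𝔤]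
    (𝔥 : LieSubalgebra ℂ 𝔤) : Prop :=
  𝔥.IsCartanSubalgebra ∧
    ∀ χ : Module.Dual ℂ 𝔥, rootSpace (adRep 𝔥) χ = rootSpace (leftRep 𝔥) χ

/-- The real case: the real parts of the root subspaces of `ad` and `L` with respect to the
Cartan subalgebra `𝔥` coincide. -/
def IsCanonicalReal {𝔤 : Type*} [LeftPreLieRing 𝔤] [LeftPreLieAlgebra ℝ 𝔤]
    (𝔥 : LieSubalgebra ℝ 𝔤) : Prop :=
  𝔥.IsCartanSubalgebra ∧
    ∀ χ : Module.Dual ℂ (ℂ ⊗[ℝ] 𝔥), realRootSpace (adRep 𝔥) χ = realRootSpace (leftRep 𝔥) χ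

/-- `V` is the direct sum of the distinct members of a set of subspaces. -/
def IsDirectSumOf {V : Type*} [AddCommGroup V] [Module K V] (S : Set (Submodule K V)) : Prop :=
  sSupIndep S ∧ sSup S = ⊤

/-- `S` is the semisimple part of `A` (in the additive Jordan decomposition). -/
def IsSemisimplePart {V : Type*} [AddCommGroup V] [Module K V] (A S : Module.End K V) : Prop :=
  S.IsSemisimple ∧ IsNilpotent (A - S) ∧ Commute A S

end Canonical

end LeftSymmetric

/-! Write M_a(v) = v + v * a; this is `orbitDiff` at (1, a). Left symmetry gives an intertwining
relation: applying the vector field of x to the point (1, a) corresponds to L(x) M_a - M_a ad(x).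
Hence, if the field of x is nilpotent on (1, a), then M_a carries generalized eigenspaces of ad(x)
into those of L(x), and onto them when M_a is injective (`map_maxGenEigenspace_eq`). At a = 0, where
M_0 = 1, the condition reads L(x)^n x = 0, and it forces ad(x) and L(x) to have the same generalized
eigenspaces (`maxGenEigenspace_ad_eq`). The canonical Cartan subalgebras are therefore those in
which every x satisfies L(x)^n x = 0 (`IsLeftNilCartan`).

Existence. The affine group conjugates the maps M_a into one another up to Lie automorphisms, so
completeness makes every M_a injective. For x with Cartan Engel subalgebra, Fitting's lemma for L(x)
gives a point a at which the field of x is nilpotent; transitivity moves a to 0 and replaces x by an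
automorphic image with L(x)^n x = 0. Injectivity of the M_a then spreads this property over the
whole Engel subalgebra (`isLeftNilCartan_engel`).

Uniqueness over ℂ. Let 𝔥 be the Engel subalgebra of x. The semisimple part S of ad(x) is a
derivation of the product, and derivations preserve every left nil Cartan subalgebra 𝔥'
(`IsLeftNilCartan.map_mem_of_derivation`). Removing from a regular element of 𝔥' its components with
nonzero S-eigenvalue changes no weight, as these components are sums of ad-nilpotent elements of 𝔥'.
What remains lies in 𝔥 and has Engel subalgebra inside 𝔥', so 𝔥 ≤ 𝔥'.

The real case is reduced to the complex one: a polynomial identity in a real parameter extends to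
complex values, so left nil Cartan subalgebras complexify. The direct sum comes from weight space
theory, and the common semisimple part from the equality of generalized eigenspaces. -/

namespace LeftSymmetric

/-! ### Bilinear intertwining and generalized eigenspaces -/

section Intertwining

variable {K V W : Type*} [Field K] [AddCommGroup V] [Module K V] [AddCommGroup W] [Module K W]
  {L B : Module.End K V} {A : Module.End K W} {Ψ : W →ₗ[K] Module.End K V}

/-- A Leibniz rule: the relation `h` says L acts on Ψ w v as A on w plus B on v, so each term of the
expanded power has too many factors on one side or the other. -/
theorem pow_sub_algebraMap_apply_eq_zero (h : ∀ w v, Ψ (A w) v = L (Ψ w v) - Ψ w (B v)) (μ : K)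
    (k : ℕ) : ∀ (m n : ℕ) (w : W) (v : V), m + n ≤ k → (A ^ m) w = 0 →
      ((B - algebraMap K _ μ) ^ n) v = 0 → ((L - algebraMap K _ μ) ^ k) (Ψ w v) = 0 := by
  induction k with
  | zero =>
    intro m n w v hk hm hn
    obtain rfl : m = 0 := by omega
    have : w = 0 := by simpa using hm
    simp [this]
  | succ k ih =>
    intro m n w v hk hm hn
    have key : (L - algebraMap K _ μ) (Ψ w v) = Ψ (A w) v + Ψ w ((B - algebraMap K _ μ) v) := by
      simp [h, Module.algebraMap_end_apply]
    rw [pow_succ, Module.End.mul_apply, key, map_add]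
    rcases m with _ | m
    · have : w = 0 := by simpa using hm
      simp [this]
    rcases n with _ | n
    · have : v = 0 := by simpa using hn
      simp [this]
    rw [ih m (n + 1) (A w) v (by omega) (by rw [← Module.End.mul_apply, ← pow_succ, hm]) hn,
      ih (m + 1) n w _ (by omega) hm (by rw [← Module.End.mul_apply, ← pow_succ, hn]), add_zero]

theorem apply_mem_maxGenEigenspace (h : ∀ w v, Ψ (A w) v = L (Ψ w v) - Ψ w (B v)) {μ : K}
    {w : W} {v : V} (hw : ∃ m : ℕ, (A ^ m) w = 0) (hv : v ∈ B.maxGenEigenspace μ) :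
    Ψ w v ∈ L.maxGenEigenspace μ := by
  obtain ⟨m, hm⟩ := hw
  obtain ⟨n, hn⟩ := (Module.End.mem_maxGenEigenspace _ _ _).1 hv
  exact (Module.End.mem_maxGenEigenspace _ _ _).2
    ⟨m + n, pow_sub_algebraMap_apply_eq_zero h μ _ m n w v le_rfl hm hn⟩

/-- Each B inside Ψ w can be traded for an L outside, at the cost of a term with A w in place of w;
at most m powers are lost in this way. -/
theorem apply_pow_mem_range (h : ∀ w v, Ψ (A w) v = L (Ψ w v) - Ψ w (B v)) (m : ℕ) :
    ∀ (n : ℕ) (w : W) (v : V), (A ^ m) w = 0 → Ψ w ((B ^ (n + m)) v) ∈ LinearMap.range (L ^ n) := by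
  induction m with
  | zero =>
    intro n w v hw
    have : w = 0 := by simpa using hw
    simp [this]
  | succ m ihm =>
    intro n
    induction n with
    | zero => intro w v _; simp
    | succ n ihn =>
      intro w v hw
      have key : Ψ w ((B ^ (n + 1 + (m + 1))) v) = L (Ψ w ((B ^ (n + (m + 1))) v))
          - Ψ (A w) ((B ^ (n + 1 + m)) v) := by
        have e1 : (B ^ (n + 1 + (m + 1))) v = B ((B ^ (n + 1 + m)) v) := by
          rw [← Module.End.mul_apply, ← pow_succ']; rfl
        have e2 : n + (m + 1) = n + 1 + m := by omega
        rw [e1, e2, h]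
        abel
      rw [key]
      refine Submodule.sub_mem _ ?_ (ihm (n + 1) (A w) v ?_)
      · obtain ⟨u, hu⟩ := ihn w v hw
        exact ⟨u, by rw [← hu, pow_succ', Module.End.mul_apply]⟩
      · rw [← Module.End.mul_apply, ← pow_succ, hw]

/-- One inclusion is the Leibniz rule. For the dimensions, Ψ w also embeds the range of a high power
of B - μ in the range of a power of L - μ, and rank-nullity reverses the inequality. Working with
one μ at a time avoids any need for the eigenvalues to lie in K. -/
theorem map_maxGenEigenspace_eq [FiniteDimensional K V]
    (h : ∀ w v, Ψ (A w) v = L (Ψ w v) - Ψ w (B v)) (μ : K) {w : W}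
    (hw : ∃ m : ℕ, (A ^ m) w = 0) (hinj : Function.Injective (Ψ w)) :
    (B.maxGenEigenspace μ).map (Ψ w) = L.maxGenEigenspace μ := by
  have hle : (B.maxGenEigenspace μ).map (Ψ w) ≤ L.maxGenEigenspace μ := by
    rintro _ ⟨v, hv, rfl⟩
    exact apply_mem_maxGenEigenspace h hw hv
  refine Submodule.eq_of_le_of_finrank_le hle ?_
  obtain ⟨m, hm⟩ := hw
  rw [(Submodule.equivMapOfInjective _ hinj _).finrank_eq.symm]
  set L' := L - algebraMap K _ μ
  set B' := B - algebraMap K _ μ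
  have h' : ∀ w v, Ψ (A w) v = L' (Ψ w v) - Ψ w (B' v) := by
    intro w v
    simp [L', B', h, Module.algebraMap_end_apply]
  -- The power N already exhausts the generalized eigenspace of L; the extra m on the B side pays
  -- for the loss in `apply_pow_mem_range`.
  let N := Module.finrank K V
  have hLN : L.maxGenEigenspace μ = LinearMap.ker (L' ^ N) := by
    rw [Module.End.maxGenEigenspace_eq_genEigenspace_finrank, Module.End.genEigenspace_nat]; rfl
  have hBN : LinearMap.ker (B' ^ (N + m)) ≤ B.maxGenEigenspace μ := by
    intro v hv
    exact (Module.End.mem_maxGenEigenspace _ _ _).2 ⟨N + m, hv⟩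
  refine le_trans ?_ (Submodule.finrank_mono hBN)
  rw [hLN]
  have hr : (LinearMap.range (B' ^ (N + m))).map (Ψ w) ≤ LinearMap.range (L' ^ N) := by
    rintro _ ⟨_, ⟨v, rfl⟩, rfl⟩
    exact apply_pow_mem_range h' m N w v hm
  have hr' := Submodule.finrank_mono hr
  rw [(Submodule.equivMapOfInjective _ hinj _).finrank_eq.symm] at hr'
  have r1 := LinearMap.finrank_range_add_finrank_ker (L' ^ N)
  have r2 := LinearMap.finrank_range_add_finrank_ker (B' ^ (N + m))
  omega

/-- Fitting's lemma: modulo the nilpotent part of f, every x lies in the image of f. For f = L(x)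
this produces a point at which the affine field of x is nilpotent. -/
theorem exists_pow_apply_add_eq_zero [FiniteDimensional K V] (f : Module.End K V) (x : V) :
    ∃ (a : V) (n : ℕ), (f ^ n) (f a + x) = 0 := by
  obtain ⟨n, hn⟩ := monotone_stabilizes_iff_artinian.mpr inferInstance f.iterateRange
  have h1 : (f ^ n) x ∈ LinearMap.range (f ^ (n + 1)) := by
    have := hn (n + 1) (by omega)
    change LinearMap.range (f ^ n) = LinearMap.range (f ^ (n + 1)) at this
    rw [← this]
    exact ⟨x, rfl⟩
  obtain ⟨b, hb⟩ := h1
  refine ⟨-b, n, ?_⟩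
  rw [map_add, map_neg, map_neg, ← Module.End.mul_apply, ← pow_succ, hb, neg_add_cancel]

theorem mem_maxGenEigenspace_zero {f : Module.End K V} {v : V} :
    v ∈ f.maxGenEigenspace 0 ↔ ∃ n : ℕ, (f ^ n) v = 0 := by
  simp [Module.End.mem_maxGenEigenspace]

theorem mem_maxGenEigenspace_zero_of_apply {f : Module.End K V} {v : V}
    (h : f v ∈ f.maxGenEigenspace 0) : v ∈ f.maxGenEigenspace 0 := by
  obtain ⟨n, hn⟩ := mem_maxGenEigenspace_zero.1 h
  exact mem_maxGenEigenspace_zero.2 ⟨n + 1, by rw [pow_succ, Module.End.mul_apply, hn]⟩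

end Intertwining

/-! ### Left multiplications against the adjoint representation -/

section LeftMul

variable {𝕜 𝔤 : Type*} [RCLike 𝕜] [LeftPreLieRing 𝔤] [LeftPreLieAlgebra 𝕜 𝔤]

theorem lie_eq_mul_sub_mul (x y : 𝔤) : ⁅x, y⁆ = x * y - y * x := rfl

theorem lie_mul_eq (x y z : 𝔤) : ⁅x, y⁆ * z = x * (y * z) - y * (x * z) := by
  have h := LeftPreLieRing.assoc_symm x y z
  rw [associator_apply, associator_apply] at h
  rw [lie_eq_mul_sub_mul, sub_mul]
  grind

variable (𝕜) in
/-- The operator `y ↦ x * y` of left multiplication. -/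
abbrev leftMul (x : 𝔤) : Module.End 𝕜 𝔤 := LinearMap.mul 𝕜 𝔤 x

variable (𝕜 𝔤) in
/-- The evaluation map `(t, y) ↦ (v ↦ t • v + v * y)`; at `(1, y)` this is the differential of
the orbit map of the affine action at the point `y`. -/
noncomputable def orbitDiff : (𝕜 × 𝔤) →ₗ[𝕜] Module.End 𝕜 𝔤 :=
  (LinearMap.toSpanSingleton 𝕜 (Module.End 𝕜 𝔤) 1).coprod (LinearMap.mul 𝕜 𝔤).flip

@[simp]
theorem orbitDiff_apply (t : 𝕜) (y v : 𝔤) : orbitDiff 𝕜 𝔤 (t, y) v = t • v + v * y := by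
  simp [orbitDiff]

theorem orbitDiff_one_zero : orbitDiff 𝕜 𝔤 (1, 0) = 1 := by
  ext v
  simp

theorem leftMul_intertwine (x w v : 𝔤) :
    LinearMap.mul 𝕜 𝔤 (LieAlgebra.ad 𝕜 𝔤 x w) v
      = leftMul 𝕜 x (LinearMap.mul 𝕜 𝔤 w v) - LinearMap.mul 𝕜 𝔤 w (leftMul 𝕜 x v) := by
  simp [lie_mul_eq]

theorem orbitDiff_intertwine (x : 𝔤) (w : 𝕜 × 𝔤) (v : 𝔤) :
    orbitDiff 𝕜 𝔤 (affineField 𝕜 x w) v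
      = leftMul 𝕜 x (orbitDiff 𝕜 𝔤 w v) - orbitDiff 𝕜 𝔤 w (LieAlgebra.ad 𝕜 𝔤 x v) := by
  obtain ⟨t, y⟩ := w
  have h := lie_mul_eq x v y
  rw [affineField_apply]
  simp only [orbitDiff_apply, LieAlgebra.ad_apply, LinearMap.mul_apply', zero_smul, zero_add,
    mul_add, h, mul_smul_comm]
  rw [lie_eq_mul_sub_mul, smul_sub]
  abel

theorem affineField_pow_succ_apply (x y : 𝔤) (n : ℕ) :
    (affineField 𝕜 x ^ (n + 1)) (1, y) = (0, (leftMul 𝕜 x ^ n) (x * y + x)) := by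
  induction n with
  | zero => simp [affineField_apply]
  | succ n ih =>
    rw [pow_succ', Module.End.mul_apply, ih, affineField_apply, pow_succ', Module.End.mul_apply]
    simp

/-- The intertwining at the point (1, 0), where the orbit differential is the identity. -/
theorem maxGenEigenspace_ad_eq [FiniteDimensional 𝕜 𝔤] {x : 𝔤}
    (hx : ∃ n : ℕ, (leftMul 𝕜 x ^ n) x = 0) (μ : 𝕜) :
    (LieAlgebra.ad 𝕜 𝔤 x).maxGenEigenspace μ = (leftMul 𝕜 x).maxGenEigenspace μ := by
  have h := map_maxGenEigenspace_eq (orbitDiff_intertwine (𝕜 := 𝕜) x) μ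
    (w := ((1 : 𝕜), (0 : 𝔤))) ?_ ?_
  · rwa [orbitDiff_one_zero, Module.End.one_eq_id, Submodule.map_id] at h
  · obtain ⟨n, hn⟩ := hx
    refine ⟨n + 1, ?_⟩
    rw [affineField_pow_succ_apply, mul_zero, zero_add, hn]
    rfl
  · rw [orbitDiff_one_zero]
    exact Function.injective_id

/-- Left multiplication by `u` maps generalized eigenspaces as expected. -/
theorem mul_mem_maxGenEigenspace {x u v : 𝔤} {μ ν : 𝕜}
    (hu : u ∈ (LieAlgebra.ad 𝕜 𝔤 x).maxGenEigenspace μ)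
    (hv : v ∈ (leftMul 𝕜 x).maxGenEigenspace ν) :
    u * v ∈ (leftMul 𝕜 x).maxGenEigenspace (μ + ν) := by
  -- Shifting ad(x) by μ keeps the intertwining relation if L(x) is shifted by μ as well, which
  -- reduces to u being killed by a power.
  have h : ∀ w v : 𝔤, LinearMap.mul 𝕜 𝔤 ((LieAlgebra.ad 𝕜 𝔤 x - algebraMap 𝕜 _ μ) w) v
      = (leftMul 𝕜 x - algebraMap 𝕜 _ μ) (LinearMap.mul 𝕜 𝔤 w v)
        - LinearMap.mul 𝕜 𝔤 w (leftMul 𝕜 x v) := by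
    intro w v
    have := leftMul_intertwine (𝕜 := 𝕜) x w v
    simp only [LinearMap.sub_apply, Module.algebraMap_end_apply, map_sub, this, map_smul,
      LinearMap.smul_apply]
    abel
  have := apply_mem_maxGenEigenspace h
    ((Module.End.mem_maxGenEigenspace _ _ _).1 hu) hv
  obtain ⟨n, hn⟩ := (Module.End.mem_maxGenEigenspace _ _ _).1 this
  refine (Module.End.mem_maxGenEigenspace _ _ _).2 ⟨n, ?_⟩
  rwa [show leftMul 𝕜 x - (μ + ν) • (1 : Module.End 𝕜 𝔤)
    = leftMul 𝕜 x - algebraMap 𝕜 _ μ - ν • 1 by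
      rw [add_smul, sub_sub, Algebra.algebraMap_eq_smul_one]]

end LeftMul

/-! ### Exponentials of intertwined operators -/

section Exponential

variable {𝕜 V W : Type*} [RCLike 𝕜] [AddCommGroup V] [Module 𝕜 V] [FiniteDimensional 𝕜 V]
  [AddCommGroup W] [Module 𝕜 W] [FiniteDimensional 𝕜 W]

theorem hasSum_map_exp {A : Type*} [NormedRing A] [NormedAlgebra 𝕜 A] [FiniteDimensional 𝕜 A]
    (Φ : A →ₗ[𝕜] 𝕜) (a : A) :
    HasSum (fun k : ℕ => ((k.factorial : 𝕜)⁻¹) • Φ (a ^ k)) (Φ (NormedSpace.exp a)) := by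
  have hcomp : CompleteSpace A := FiniteDimensional.complete 𝕜 A
  have h := (NormedSpace.exp_series_hasSum_exp' (𝕂 := 𝕜) a).map Φ Φ.continuous_of_finiteDimensional
  convert h using 1
  ext k
  simp

theorem hasSum_dual_linExp (A : Module.End 𝕜 V) (ℓ : Module.Dual 𝕜 V) (v : V) :
    HasSum (fun k : ℕ => ((k.factorial : 𝕜)⁻¹) • ℓ ((A ^ k) v)) (ℓ (linExp A v)) := by
  let b := Module.finBasis 𝕜 V
  let Φ : Matrix (Fin (Module.finrank 𝕜 V)) (Fin (Module.finrank 𝕜 V)) 𝕜 →ₗ[𝕜] 𝕜 :=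
    ℓ ∘ₗ LinearMap.applyₗ v ∘ₗ (Matrix.toLin b b).toLinearMap
  have h : HasSum (fun k : ℕ => ((k.factorial : 𝕜)⁻¹) • Φ (LinearMap.toMatrix b b A ^ k))
      (Φ (NormedSpace.exp (LinearMap.toMatrix b b A))) := by
    let _ : NormedRing (Matrix (Fin (Module.finrank 𝕜 V)) (Fin (Module.finrank 𝕜 V)) 𝕜) :=
      Matrix.linftyOpNormedRing
    let _ : NormedAlgebra 𝕜 (Matrix (Fin (Module.finrank 𝕜 V)) (Fin (Module.finrank 𝕜 V)) 𝕜) :=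
      Matrix.linftyOpNormedAlgebra
    exact hasSum_map_exp Φ _
  have e : ∀ k : ℕ, Φ (LinearMap.toMatrix b b A ^ k) = ℓ ((A ^ k) v) := by
    intro k
    change ℓ (Matrix.toLin b b (LinearMap.toMatrix b b A ^ k) v) = _
    rw [LinearMap.toMatrix_pow, Matrix.toLin_toMatrix]
  simp only [e] at h
  exact h

/-- Both sides are compared through linear functionals, where the exponential is a convergent scalar
series. -/
theorem map_linExp_apply {f : V →ₗ[𝕜] W} {A : Module.End 𝕜 V} {B : Module.End 𝕜 W}
    (h : ∀ v, f (A v) = B (f v)) (v : V) : f (linExp A v) = linExp B (f v) := by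
  rw [← sub_eq_zero, ← Module.forall_dual_apply_eq_zero_iff (R := 𝕜)]
  intro ℓ
  rw [map_sub, sub_eq_zero]
  refine (hasSum_dual_linExp A (ℓ ∘ₗ f) v).unique ?_
  convert hasSum_dual_linExp B ℓ (f v) using 1
  ext k
  have : ∀ k : ℕ, f ((A ^ k) v) = (B ^ k) (f v) := by
    intro k
    induction k with
    | zero => rfl
    | succ k ih => rw [pow_succ', Module.End.mul_apply, h, ih, pow_succ', Module.End.mul_apply]
  simp [this]

theorem linExp_add_of_commute {A B : Module.End 𝕜 V} (h : Commute A B) :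
    linExp (A + B) = linExp A * linExp B := by
  have hc : Commute (LinearMap.toMatrix (Module.finBasis 𝕜 V) (Module.finBasis 𝕜 V) A)
      (LinearMap.toMatrix (Module.finBasis 𝕜 V) (Module.finBasis 𝕜 V) B) := by
    simp only [commute_iff_eq, ← LinearMap.toMatrix_mul, h.eq]
  rw [linExp, map_add, Matrix.exp_add_of_commute _ _ hc,
    Matrix.toLin_mul (Module.finBasis 𝕜 V) (Module.finBasis 𝕜 V)]
  rfl

theorem linExp_zero : linExp (0 : Module.End 𝕜 V) = 1 := by
  rw [linExp, map_zero, NormedSpace.exp_zero, Matrix.toLin_one]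
  rfl

/-- The exponential of an endomorphism, as a linear equivalence. -/
noncomputable def linExpEquiv (A : Module.End 𝕜 V) : V ≃ₗ[𝕜] V :=
  LinearEquiv.ofLinearMap (linExp A) (linExp (-A))
    (by rw [← Module.End.mul_eq_comp, ← linExp_add_of_commute ((Commute.refl A).neg_right),
      add_neg_cancel, linExp_zero]; rfl)
    (by rw [← Module.End.mul_eq_comp, ← linExp_add_of_commute ((Commute.refl A).neg_left),
      neg_add_cancel, linExp_zero]; rfl)

@[simp]
theorem linExpEquiv_apply (A : Module.End 𝕜 V) (v : V) : linExpEquiv A v = linExp A v := rfl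

/-- The relation says that the map W ⊗ V → V induced by Ψ intertwines A ⊗ 1 + 1 ⊗ B with L; the two
summands commute, so the exponential of the sum factors. -/
theorem linExp_intertwine {A : Module.End 𝕜 W} {L B : Module.End 𝕜 V}
    {Ψ : W →ₗ[𝕜] Module.End 𝕜 V} (h : ∀ w v, Ψ (A w) v = L (Ψ w v) - Ψ w (B v)) (w : W) (v : V) :
    Ψ (linExp A w) (linExp B v) = linExp L (Ψ w v) := by
  let m : W ⊗[𝕜] V →ₗ[𝕜] V := TensorProduct.lift Ψ
  have hm : ∀ z, m ((A.rTensor V + B.lTensor W) z) = L (m z) := by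
    intro z
    induction z with
    | zero => simp
    | add x y hx hy => simp only [map_add, hx, hy]
    | tmul w v => simp [m, h]
  have hc : Commute (A.rTensor V) (B.lTensor W) := by
    rw [commute_iff_eq, Module.End.mul_eq_comp, Module.End.mul_eq_comp,
      LinearMap.rTensor_comp_lTensor, LinearMap.lTensor_comp_rTensor]
  have h1 : linExp (B.lTensor W) (w ⊗ₜ v) = w ⊗ₜ linExp B v :=
    (map_linExp_apply (f := TensorProduct.mk 𝕜 W V w) (A := B) (B := B.lTensor W)
      (fun _ => rfl) v).symm
  have h2 : ∀ v, linExp (A.rTensor V) (w ⊗ₜ v) = linExp A w ⊗ₜ v := fun v =>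
    (map_linExp_apply (f := (TensorProduct.mk 𝕜 W V).flip v) (A := A) (B := A.rTensor V)
      (fun _ => rfl) w).symm
  have h3 := map_linExp_apply hm (w ⊗ₜ v)
  rwa [linExp_add_of_commute hc, Module.End.mul_apply, h1, h2] at h3

end Exponential

/-! ### The affine group and the orbit differentials -/

section Group

variable {𝕜 𝔤 : Type*} [RCLike 𝕜] [LeftPreLieRing 𝔤] [LeftPreLieAlgebra 𝕜 𝔤]

theorem ad_intertwine (x w v : 𝔤) :
    (LieAlgebra.ad 𝕜 𝔤 : 𝔤 →ₗ[𝕜] Module.End 𝕜 𝔤) (LieAlgebra.ad 𝕜 𝔤 x w) v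
      = LieAlgebra.ad 𝕜 𝔤 x ((LieAlgebra.ad 𝕜 𝔤 : 𝔤 →ₗ[𝕜] Module.End 𝕜 𝔤) w v)
        - (LieAlgebra.ad 𝕜 𝔤 : 𝔤 →ₗ[𝕜] Module.End 𝕜 𝔤) w (LieAlgebra.ad 𝕜 𝔤 x v) := by
  simp

variable [FiniteDimensional 𝕜 𝔤]

variable (𝕜) in
/-- The inner automorphism `exp (ad x)` of the Lie algebra. -/
noncomputable def expAd (x : 𝔤) : 𝔤 ≃ₗ⁅𝕜⁆ 𝔤 :=
  { linExpEquiv (LieAlgebra.ad 𝕜 𝔤 x) with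
    map_lie' := by
      intro y z
      exact (linExp_intertwine (ad_intertwine (𝕜 := 𝕜) x) y z).symm }

theorem expAd_apply (x y : 𝔤) : expAd 𝕜 x y = linExp (LieAlgebra.ad 𝕜 𝔤 x) y := rfl

/-- Every element of the affine group intertwines the differentials of the orbit maps, up to an
automorphism of the Lie algebra. -/
theorem exists_lieEquiv_of_mem_affineGroup {φ : 𝔤 ≃ᵃ[𝕜] 𝔤} (hφ : φ ∈ affineGroup 𝕜 𝔤) :
    ∃ (T : 𝔤 ≃ₗ[𝕜] 𝔤) (A : 𝔤 ≃ₗ⁅𝕜⁆ 𝔤), (∀ z u, A z * T u = T (z * u)) ∧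
      ∀ y v, A v + A v * φ y = T (v + v * y) := by
  induction hφ using Subgroup.closure_induction with
  | mem φ hφ =>
    obtain ⟨x, hx⟩ := hφ
    refine ⟨linExpEquiv (leftMul 𝕜 x), expAd 𝕜 x, fun z u => ?_, fun y v => ?_⟩
    · exact linExp_intertwine (leftMul_intertwine (𝕜 := 𝕜) x) z u
    · have h := linExp_intertwine (orbitDiff_intertwine (𝕜 := 𝕜) x) (1, y) v
      rw [hx y] at h
      simpa [expAd_apply] using h
  | one => exact ⟨LinearEquiv.refl 𝕜 𝔤, LieEquiv.refl, fun _ _ => rfl, fun _ _ => rfl⟩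
  | mul φ ψ _ _ hφ hψ =>
    obtain ⟨T, A, h1, h2⟩ := hφ
    obtain ⟨T', A', h1', h2'⟩ := hψ
    refine ⟨T'.trans T, A'.trans A, fun z u => ?_, fun y v => ?_⟩
    · simp [h1, h1']
    · change A (A' v) + A (A' v) * φ (ψ y) = T (T' (v + v * y))
      rw [h2, h2']
  | inv φ _ hφ =>
    obtain ⟨T, A, h1, h2⟩ := hφ
    refine ⟨T.symm, A.symm, fun z u => ?_, fun y v => ?_⟩
    · rw [T.eq_symm_apply, ← h1, A.apply_symm_apply, T.apply_symm_apply]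
    · rw [T.eq_symm_apply, ← h2, A.apply_symm_apply]
      congr 2
      exact AffineEquiv.apply_symm_apply φ y

theorem IsComplete.exists_lieEquiv (h : IsComplete 𝕜 𝔤) (a : 𝔤) :
    ∃ (T : 𝔤 ≃ₗ[𝕜] 𝔤) (A : 𝔤 ≃ₗ⁅𝕜⁆ 𝔤), (∀ z u, A z * T u = T (z * u)) ∧
      ∀ v, A v + A v * a = T v := by
  obtain ⟨φ, hφ, h0⟩ := h 0 a
  obtain ⟨T, A, h1, h2⟩ := exists_lieEquiv_of_mem_affineGroup hφ
  refine ⟨T, A, h1, fun v => ?_⟩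
  have := h2 0 v
  rwa [h0, mul_zero, add_zero] at this

/-- Transitivity makes every orbit differential equal to the one at 0, which is the identity, up to
invertible maps on both sides. -/
theorem IsComplete.injective_orbitDiff (h : IsComplete 𝕜 𝔤) (a : 𝔤) :
    Function.Injective (orbitDiff 𝕜 𝔤 (1, a)) := by
  obtain ⟨T, A, -, h2⟩ := h.exists_lieEquiv a
  intro v w hvw
  have h3 : ∀ v, orbitDiff 𝕜 𝔤 (1, a) v = T (A.symm v) := by
    intro v
    rw [← h2, A.apply_symm_apply, orbitDiff_apply, one_smul]
  rw [h3, h3] at hvw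
  exact A.symm.injective (T.injective hvw)

end Group

/-! ### Cartan subalgebras as Engel subalgebras -/

section Cartan

variable {K L : Type*} [Field K] [LieRing L] [LieAlgebra K L]

theorem le_engel_of_isNilpotent {H : LieSubalgebra K L} (hH : LieRing.IsNilpotent H) {x : L}
    (hx : x ∈ H) : H ≤ LieSubalgebra.engel K x := by
  intro y hy
  have h := LieAlgebra.le_zeroRootSubalgebra K L H hy
  rw [LieAlgebra.mem_zeroRootSubalgebra] at h
  exact (LieSubalgebra.mem_engel_iff K x y).2 (h ⟨x, hx⟩)

theorem mem_engel_map_iff (A : L ≃ₗ⁅K⁆ L) (x y : L) :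
    A y ∈ LieSubalgebra.engel K (A x) ↔ y ∈ LieSubalgebra.engel K x := by
  have h : ∀ n : ℕ, (LieAlgebra.ad K L (A x) ^ n) (A y) = A ((LieAlgebra.ad K L x ^ n) y) := by
    intro n
    induction n with
    | zero => rfl
    | succ n ih =>
      rw [pow_succ', Module.End.mul_apply, ih, pow_succ', Module.End.mul_apply]
      exact (LieHom.map_lie A.toLieHom _ _).symm
  simp only [LieSubalgebra.mem_engel_iff, h]
  simp

variable [FiniteDimensional K L]

theorem mem_of_forall_mem_engel {H : LieSubalgebra K L} (hH : H.IsCartanSubalgebra) {v : L}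
    (hv : ∀ y ∈ H, v ∈ LieSubalgebra.engel K y) : v ∈ H := by
  rw [← LieAlgebra.zeroRootSubalgebra_eq_of_is_cartan K L H, LieAlgebra.mem_zeroRootSubalgebra]
  intro y
  exact (LieSubalgebra.mem_engel_iff K _ v).1 (hv y y.2)

/-- A Cartan subalgebra is the Engel subalgebra of one of its elements. -/
theorem exists_engel_eq_of_isCartanSubalgebra [Infinite K] {H : LieSubalgebra K L}
    (hH : H.IsCartanSubalgebra) : ∃ x ∈ H, LieSubalgebra.engel K x = H := by
  -- An element of H with Engel subalgebra of least dimension; over an infinite field this Engel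
  -- subalgebra lies in those of all elements of H.
  obtain ⟨x, hx, hmin⟩ := (measure fun x : L =>
    Module.finrank K (LieSubalgebra.engel K x)).wf.has_min (H : Set L) ⟨0, H.zero_mem⟩
  refine ⟨x, hx, le_antisymm (fun v hv => mem_of_forall_mem_engel hH fun y hy => ?_)
    (le_engel_of_isNilpotent hH.nilpotent hx)⟩
  let E : {LieSubalgebra.engel K x | x ∈ H} := ⟨LieSubalgebra.engel K x, x, hx, rfl⟩
  have hcard : (Module.finrank K L : Cardinal) ≤ Cardinal.mk K :=
    Cardinal.natCast_le_aleph0.trans <| Cardinal.infinite_iff.mp ‹Infinite K›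
  have hbot : IsBot E := by
    refine LieAlgebra.engel_isBot_of_isMin hcard H E (le_engel_of_isNilpotent hH.nilpotent hx) ?_
    rintro ⟨_, z, hz, rfl⟩ hzx
    have h1 : Module.finrank K (LieSubalgebra.engel K x)
        ≤ Module.finrank K (LieSubalgebra.engel K z) := not_lt.1 (hmin z hz)
    have h2 : LieSubalgebra.engel K z = LieSubalgebra.engel K x :=
      LieSubalgebra.toSubmodule_injective (Submodule.eq_of_le_of_finrank_le hzx h1)
    exact h2.ge
  exact hbot ⟨LieSubalgebra.engel K y, y, hy, rfl⟩ hv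

theorem isCartanSubalgebra_engel_of_lieEquiv (A : L ≃ₗ⁅K⁆ L) {x : L}
    (hx : (LieSubalgebra.engel K (A x)).IsCartanSubalgebra) :
    (LieSubalgebra.engel K x).IsCartanSubalgebra := by
  refine ⟨LieSubalgebra.isNilpotent_of_forall_le_engel _ fun y hy z hz => ?_,
    LieSubalgebra.normalizer_engel K x⟩
  rw [← mem_engel_map_iff A] at hy hz ⊢
  exact le_engel_of_isNilpotent hx.nilpotent hy hz

end Cartan

/-! ### Left nil Cartan subalgebras: existence and stability under derivations -/

section LeftNil

variable {𝕜 𝔤 : Type*} [RCLike 𝕜] [LeftPreLieRing 𝔤] [LeftPreLieAlgebra 𝕜 𝔤]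

/-- A Cartan subalgebra all of whose elements `x` are killed by a power of the left
multiplication by `x`. -/
structure IsLeftNilCartan (𝔥 : LieSubalgebra 𝕜 𝔤) : Prop where
  cartan : 𝔥.IsCartanSubalgebra
  leftNil : ∀ x ∈ 𝔥, ∃ n : ℕ, (leftMul 𝕜 x ^ n) x = 0

variable [FiniteDimensional 𝕜 𝔤]

theorem mem_engel_iff_leftMul {x : 𝔤} (hx : ∃ n : ℕ, (leftMul 𝕜 x ^ n) x = 0) {v : 𝔤} :
    v ∈ LieSubalgebra.engel 𝕜 x ↔ ∃ n : ℕ, (leftMul 𝕜 x ^ n) v = 0 := by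
  rw [← mem_maxGenEigenspace_zero, ← maxGenEigenspace_ad_eq hx, mem_maxGenEigenspace_zero,
    LieSubalgebra.mem_engel_iff]

theorem mul_mem_engel {x : 𝔤} (hx : ∃ n : ℕ, (leftMul 𝕜 x ^ n) x = 0) {u v : 𝔤}
    (hu : u ∈ LieSubalgebra.engel 𝕜 x) (hv : v ∈ LieSubalgebra.engel 𝕜 x) :
    u * v ∈ LieSubalgebra.engel 𝕜 x := by
  have hu' : u ∈ (LieAlgebra.ad 𝕜 𝔤 x).maxGenEigenspace 0 := hu
  have hv' : v ∈ (LieAlgebra.ad 𝕜 𝔤 x).maxGenEigenspace 0 := hv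
  rw [maxGenEigenspace_ad_eq hx] at hv'
  have := mul_mem_maxGenEigenspace hu' hv'
  rw [add_zero, ← maxGenEigenspace_ad_eq hx] at this
  exact this

theorem mem_engel_of_mul_mem_engel {x : 𝔤} (hx : ∃ n : ℕ, (leftMul 𝕜 x ^ n) x = 0) {v : 𝔤}
    (hv : x * v ∈ LieSubalgebra.engel 𝕜 x) : v ∈ LieSubalgebra.engel 𝕜 x := by
  rw [mem_engel_iff_leftMul hx, ← mem_maxGenEigenspace_zero] at hv ⊢
  exact mem_maxGenEigenspace_zero_of_apply hv

/-- If all differentials of orbit maps are injective, then an Engel subalgebra that is nilpotent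
consists of elements with nilpotent left multiplications. -/
theorem isLeftNilCartan_engel (hinj : ∀ a : 𝔤, Function.Injective (orbitDiff 𝕜 𝔤 (1, a))) {x : 𝔤}
    (hx : ∃ n : ℕ, (leftMul 𝕜 x ^ n) x = 0)
    (hc : (LieSubalgebra.engel 𝕜 x).IsCartanSubalgebra) :
    IsLeftNilCartan (LieSubalgebra.engel 𝕜 x) := by
  refine ⟨hc, fun z hz => ?_⟩
  set H := (LieSubalgebra.engel 𝕜 x).toSubmodule with hH
  have hmul : ∀ u ∈ H, ∀ v ∈ H, u * v ∈ H := fun u hu v hv => mul_mem_engel hx hu hv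
  have hres : ∀ v ∈ H, leftMul 𝕜 z v ∈ H := fun v hv => hmul z hz v hv
  -- Fitting's lemma is applied inside H so that a lies in H and M_a preserves H; injectivity then
  -- makes M_a surjective on H, and z = M_a u with u in H.
  obtain ⟨a, n, han⟩ := exists_pow_apply_add_eq_zero ((leftMul 𝕜 z).restrict hres) ⟨z, hz⟩
  have han' : (leftMul 𝕜 z ^ n) (z * a + z) = 0 := by
    rw [Module.End.pow_restrict _] at han
    simpa using congrArg Subtype.val han
  have hM : ∀ v ∈ H, orbitDiff 𝕜 𝔤 (1, (a : 𝔤)) v ∈ H := by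
    intro v hv
    rw [orbitDiff_apply, one_smul]
    exact H.add_mem hv (hmul v hv a a.2)
  have hsurj : Function.Surjective ((orbitDiff 𝕜 𝔤 (1, (a : 𝔤))).restrict hM) := by
    refine LinearMap.surjective_of_injective fun v w hvw => ?_
    exact Subtype.ext (hinj a (congrArg Subtype.val hvw))
  obtain ⟨u, hu⟩ := hsurj ⟨z, hz⟩
  have hu' : orbitDiff 𝕜 𝔤 (1, (a : 𝔤)) u = z := congrArg Subtype.val hu
  have hu0 : (u : 𝔤) ∈ (LieAlgebra.ad 𝕜 𝔤 z).maxGenEigenspace 0 :=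
    le_engel_of_isNilpotent hc.nilpotent hz u.2
  -- ad(z) is nilpotent on u since H is nilpotent, so M_a sends u, that is to z, into the
  -- generalized null space of L(z).
  have := apply_mem_maxGenEigenspace (orbitDiff_intertwine (𝕜 := 𝕜) z) (w := (1, (a : 𝔤)))
    ⟨n + 1, by rw [affineField_pow_succ_apply, han']; rfl⟩ hu0
  rwa [hu', mem_maxGenEigenspace_zero] at this

theorem IsComplete.exists_isLeftNilCartan (h : IsComplete 𝕜 𝔤) :
    ∃ 𝔥 : LieSubalgebra 𝕜 𝔤, IsLeftNilCartan 𝔥 := by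
  obtain ⟨x, hx⟩ := LieAlgebra.exists_isCartanSubalgebra_engel 𝕜 𝔤
  obtain ⟨a, n, han⟩ := exists_pow_apply_add_eq_zero (leftMul 𝕜 x) x
  obtain ⟨T, A, h1, h2⟩ := h.exists_lieEquiv a
  have hT : ∀ n : ℕ, T ((leftMul 𝕜 (A.symm x) ^ n) (A.symm x))
      = (leftMul 𝕜 x ^ n) (T (A.symm x)) := by
    intro n
    induction n with
    | zero => rfl
    | succ n ih =>
      rw [pow_succ', Module.End.mul_apply, LinearMap.mul_apply', ← h1, ih, pow_succ',
        Module.End.mul_apply, LinearMap.mul_apply', A.apply_symm_apply]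
  -- T carries the vector L(A⁻¹x)^n (A⁻¹x) to L(x)^n (x + x * a), which vanishes by the choice of a.
  refine ⟨_, isLeftNilCartan_engel h.injective_orbitDiff (x := A.symm x) ⟨n, ?_⟩ ?_⟩
  · apply T.injective
    rw [hT, ← h2, A.apply_symm_apply, map_zero, add_comm]
    exact han
  · refine isCartanSubalgebra_engel_of_lieEquiv A ?_
    rwa [A.apply_symm_apply]

/-- Derivations of a left-symmetric algebra preserve its left nil Cartan subalgebras. -/
theorem IsLeftNilCartan.map_mem_of_derivation {𝔥 : LieSubalgebra 𝕜 𝔤} (h : IsLeftNilCartan 𝔥)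
    {D : Module.End 𝕜 𝔤} (hD : ∀ u v, D (u * v) = D u * v + u * D v) {v : 𝔤} (hv : v ∈ 𝔥) :
    D v ∈ 𝔥 := by
  obtain ⟨x, hx, rfl⟩ := exists_engel_eq_of_isCartanSubalgebra h.cartan
  have hnil := h.leftNil x hx
  set H := LieSubalgebra.engel 𝕜 x
  -- Modulo H, D x equals -[x, w], so L(w) - D commutes with L(x) up to left multiplication by an
  -- element of H.
  obtain ⟨w, n, hw⟩ := exists_pow_apply_add_eq_zero (LieAlgebra.ad 𝕜 𝔤 x) (D x)
  have hc : ⁅x, w⁆ + D x ∈ H := (LieSubalgebra.mem_engel_iff 𝕜 x _).2 ⟨n, hw⟩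
  have hB : ∀ n : ℕ, ∀ u ∈ H, (leftMul 𝕜 x ^ n) u = 0 → w * u - D u ∈ H := by
    intro n
    induction n with
    | zero =>
      intro u _ h0
      obtain rfl : u = 0 := h0
      simp
    | succ n ih =>
      intro u hu h0
      apply mem_engel_of_mul_mem_engel hnil
      have e : x * (w * u - D u) = (w * (x * u) - D (x * u)) + (⁅x, w⁆ + D x) * u := by
        rw [hD, add_mul, lie_mul_eq, mul_sub]
        abel
      rw [e]
      refine H.add_mem (ih _ (mul_mem_engel hnil hx hu) ?_) (mul_mem_engel hnil hc hu)
      rw [← h0, pow_succ, Module.End.mul_apply, LinearMap.mul_apply']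
  have hB' : ∀ u ∈ H, w * u - D u ∈ H := by
    intro u hu
    obtain ⟨n, hn⟩ := (mem_engel_iff_leftMul hnil).1 hu
    exact hB n u hu hn
  -- Taking u = x, the sum of [x, w] + D x and w * x - D x is x * w, and L(x) detects membership in
  -- H.
  have hw : w ∈ H := by
    apply mem_engel_of_mul_mem_engel hnil
    have := H.add_mem hc (hB' x hx)
    rwa [lie_eq_mul_sub_mul, show x * w - w * x + D x + (w * x - D x) = x * w by abel] at this
  have := H.sub_mem (mul_mem_engel hnil hw hv) (hB' v hv)
  rwa [sub_sub_cancel] at this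

end LeftNil

/-! ### Semisimple parts and generalized eigenspaces -/

section SemisimplePart

variable {K V : Type*} [Field K] [AddCommGroup V] [Module K V]

theorem exists_isSemisimplePart [FiniteDimensional K V] [PerfectField K] (f : Module.End K V) :
    ∃ S, IsSemisimplePart f S := by
  obtain ⟨n, hn, s, hs, hn', hs', rfl⟩ := f.exists_isNilpotent_isSemisimple
  refine ⟨s, hs', by simpa using hn', ?_⟩
  exact (Algebra.commute_of_mem_adjoin_self hs)

theorem IsSemisimplePart.apply_eq_smul {f S : Module.End K V} (h : IsSemisimplePart f S) {μ : K}
    {v : V} (hv : v ∈ f.maxGenEigenspace μ) : S v = μ • v :=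
  Module.End.apply_eq_of_mem_of_comm_of_isFinitelySemisimple_of_isNil hv h.2.2
    h.1.isFinitelySemisimple h.2.1

theorem IsSemisimplePart.pow_apply_eq_of_apply_eq_zero {f S : Module.End K V}
    (h : IsSemisimplePart f S) {v : V} (hv : S v = 0) : v ∈ f.maxGenEigenspace 0 := by
  obtain ⟨n, hn⟩ := h.2.1
  have hc : Commute (f - S) S := h.2.2.sub_left (Commute.refl S)
  have key : ∀ n : ℕ, (f ^ n) v = ((f - S) ^ n) v := by
    intro n
    induction n with
    | zero => rfl
    | succ n ih =>
      have h0 : S (((f - S) ^ n) v) = 0 := by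
        rw [← Module.End.mul_apply, ← (hc.pow_left n).eq, Module.End.mul_apply, hv, map_zero]
      rw [pow_succ', Module.End.mul_apply, ih, pow_succ', Module.End.mul_apply,
        LinearMap.sub_apply, h0, sub_zero]
  exact mem_maxGenEigenspace_zero.2 ⟨n, by rw [key, hn]; rfl⟩

variable [FiniteDimensional K V] [IsAlgClosed K]

theorem linearMap_ext_maxGenEigenspace {W : Type*} [AddCommGroup W] [Module K W]
    (f : Module.End K V) {g g' : V →ₗ[K] W}
    (h : ∀ μ, ∀ v ∈ f.maxGenEigenspace μ, g v = g' v) : g = g' := by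
  rw [← LinearMap.eqLocus_eq_top, eq_top_iff, ← Module.End.iSup_maxGenEigenspace_eq_top f]
  exact iSup_le fun μ v hv => h μ v hv

/-- On each common generalized eigenspace S is the scalar μ, so there g - S is g - μ, which is
nilpotent, and S commutes with g. -/
theorem IsSemisimplePart.of_maxGenEigenspace_eq {f g S : Module.End K V}
    (hS : IsSemisimplePart f S) (h : ∀ μ, f.maxGenEigenspace μ = g.maxGenEigenspace μ) :
    IsSemisimplePart g S := by
  have hg : ∀ μ, ∀ v ∈ f.maxGenEigenspace μ, g v ∈ f.maxGenEigenspace μ := by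
    intro μ v hv
    rw [h] at hv ⊢
    exact Module.End.mapsTo_maxGenEigenspace_of_comm (Commute.refl g) μ hv
  refine ⟨hS.1, ⟨Module.finrank K V, ?_⟩, ?_⟩
  · refine linearMap_ext_maxGenEigenspace f fun μ v hv => ?_
    have key : ∀ n : ℕ, ((g - S) ^ n) v = ((g - μ • (1 : Module.End K V)) ^ n) v ∧
        ((g - S) ^ n) v ∈ f.maxGenEigenspace μ := by
      intro n
      induction n with
      | zero => exact ⟨rfl, hv⟩
      | succ n ih =>
        have e : (g - S) (((g - S) ^ n) v)
            = (g - μ • (1 : Module.End K V)) (((g - S) ^ n) v) := by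
          simp [hS.apply_eq_smul ih.2]
        rw [pow_succ', pow_succ', Module.End.mul_apply, Module.End.mul_apply, ← ih.1]
        refine ⟨e, ?_⟩
        rw [e]
        exact Submodule.sub_mem _ (hg μ _ ih.2) (Submodule.smul_mem _ _ ih.2)
    rw [(key _).1]
    rw [h, Module.End.maxGenEigenspace_eq_genEigenspace_finrank,
      Module.End.genEigenspace_nat] at hv
    exact hv
  · refine linearMap_ext_maxGenEigenspace f fun μ v hv => ?_
    rw [Module.End.mul_apply, Module.End.mul_apply, hS.apply_eq_smul hv,
      hS.apply_eq_smul (hg μ v hv), map_smul]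

end SemisimplePart

/-! ### Uniqueness over ℂ -/

section ComplexUniqueness

variable {𝔤 : Type*} [LeftPreLieRing 𝔤] [LeftPreLieAlgebra ℂ 𝔤] [FiniteDimensional ℂ 𝔤]

/-- Eigenvalues add under multiplication, since ad(x) and L(x) share their generalized eigenspaces.
-/
theorem IsSemisimplePart.map_mul {x : 𝔤} {S : Module.End ℂ 𝔤}
    (hS : IsSemisimplePart (LieAlgebra.ad ℂ 𝔤 x) S)
    (hx : ∃ n : ℕ, (leftMul ℂ x ^ n) x = 0) (u v : 𝔤) : S (u * v) = S u * v + u * S v := by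
  have h1 : (LinearMap.mul ℂ 𝔤).compr₂ S
      = (LinearMap.mul ℂ 𝔤).comp S + (LinearMap.mul ℂ 𝔤).compl₂ S := by
    refine linearMap_ext_maxGenEigenspace (LieAlgebra.ad ℂ 𝔤 x) fun μ u hu => ?_
    refine linearMap_ext_maxGenEigenspace (LieAlgebra.ad ℂ 𝔤 x) fun ν v hv => ?_
    have hv' := hv
    rw [maxGenEigenspace_ad_eq hx] at hv'
    have huv := mul_mem_maxGenEigenspace hu hv'
    rw [← maxGenEigenspace_ad_eq hx] at huv
    simp [hS.apply_eq_smul hu, hS.apply_eq_smul hv, hS.apply_eq_smul huv, add_smul]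
  exact LinearMap.congr_fun₂ h1 u v

/-- An eigenvector with nonzero eigenvalue of a diagonalizable derivation is ad-nilpotent. -/
theorem mem_engel_of_derivation_apply_eq_smul {L : Type*} [LieRing L] [LieAlgebra ℂ L]
    [FiniteDimensional ℂ L] {S : Module.End ℂ L} (hS : S.IsSemisimple)
    (hD : ∀ u v, S ⁅u, v⁆ = ⁅S u, v⁆ + ⁅u, S v⁆) {u : L} {ν : ℂ} (hν : ν ≠ 0)
    (hu : S u = ν • u) (v : L) : v ∈ LieSubalgebra.engel ℂ u := by
  suffices h : (⊤ : Submodule ℂ L) ≤ (LieSubalgebra.engel ℂ u).toSubmodule from h trivial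
  rw [← hS.iSup_eigenspace_eq_top]
  refine iSup_le fun μ v hv => ?_
  have hn : ∀ n : ℕ, (LieAlgebra.ad ℂ L u ^ n) v ∈ S.eigenspace (μ + n • ν) := by
    intro n
    induction n with
    | zero => simpa using hv
    | succ n ih =>
      rw [Module.End.mem_eigenspace_iff] at ih ⊢
      rw [pow_succ', Module.End.mul_apply, LieAlgebra.ad_apply, hD, hu, ih, smul_lie, lie_smul,
        ← add_smul]
      congr 1
      simp only [nsmul_eq_mul]
      push_cast
      ring
  -- Powers of ad(u) shift the S-eigenvalue by multiples of ν ≠ 0 and must leave the finite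
  -- spectrum.
  have hfin : {μ : ℂ | S.HasEigenvalue μ}.Finite := Module.End.finite_hasEigenvalue S
  have hinj : Function.Injective fun n : ℕ => μ + n • ν := by
    intro m n hmn
    simpa [hν] using hmn
  obtain ⟨n, hn'⟩ : ∃ n : ℕ, ¬ S.HasEigenvalue (μ + n • ν) := by
    by_contra! hall
    exact Set.infinite_of_injective_forall_mem hinj hall hfin
  refine (LieSubalgebra.mem_engel_iff ℂ u v).2 ⟨n, ?_⟩
  have := hn n
  rw [Module.End.HasEigenvalue, Module.End.HasUnifEigenvalue, not_not] at hn'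
  rwa [Module.End.eigenspace, hn', Submodule.mem_bot] at this

theorem weight_apply_eq_zero {L : Type*} [LieRing L] [LieAlgebra ℂ L] {H : LieSubalgebra ℂ L}
    [LieRing.IsNilpotent H] (χ : LieModule.Weight ℂ H L) {y : H}
    (hy : ∀ v, v ∈ LieSubalgebra.engel ℂ (y : L)) : χ y = 0 := by
  by_contra hne
  refine LieModule.Weight.genWeightSpace_ne_bot L χ ?_
  rw [eq_bot_iff]
  intro v hv
  have hv1 : v ∈ (LieAlgebra.ad ℂ L (y : L)).maxGenEigenspace (χ y) :=
    LieModule.genWeightSpace_le_genWeightSpaceOf L y χ hv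
  have hv2 : v ∈ (LieAlgebra.ad ℂ L (y : L)).maxGenEigenspace 0 := hy v
  exact Submodule.disjoint_def.1 (Module.End.disjoint_genEigenspace _ hne _ _) v hv1 hv2

/-- If an element `x` of a Cartan subalgebra is moved along an ad-nilpotent direction, its Engel
subalgebra does not grow. -/
theorem engel_le_of_forall_weight {L : Type*} [LieRing L] [LieAlgebra ℂ L]
    [FiniteDimensional ℂ L] {H : LieSubalgebra ℂ L} [LieRing.IsNilpotent H] {x y : H}
    (hx : LieSubalgebra.engel ℂ (x : L) ≤ H)
    (hxy : ∀ χ : LieModule.Weight ℂ H L, χ x = χ y) :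
    LieSubalgebra.engel ℂ (y : L) ≤ H := by
  let Q : Submodule ℂ L := ⨆ (μ : ℂ) (_ : μ ≠ 0), (LieAlgebra.ad ℂ L (y : L)).maxGenEigenspace μ
  have hle : ∀ (χ : LieModule.Weight ℂ H L) (z : H),
      (LieModule.genWeightSpace L χ).toSubmodule
        ≤ (LieAlgebra.ad ℂ L (z : L)).maxGenEigenspace (χ z) := fun χ z =>
    LieModule.genWeightSpace_le_genWeightSpaceOf L z χ
  -- A weight space lies in H if the weight vanishes at x, and in Q otherwise. As H lies in the
  -- Engel subalgebra of y, which meets Q trivially, that subalgebra is no larger than H.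
  have htop : (⊤ : Submodule ℂ L) ≤ H.toSubmodule ⊔ Q := by
    have := congrArg LieSubmodule.toSubmodule (LieModule.iSup_genWeightSpace_eq_top' ℂ H L)
    rw [LieSubmodule.iSup_toSubmodule, LieSubmodule.top_toSubmodule] at this
    rw [← this]
    refine iSup_le fun χ => ?_
    by_cases h0 : χ x = 0
    · refine le_trans ?_ le_sup_left
      have := hle χ x
      rw [h0] at this
      exact this.trans hx
    · refine le_trans ?_ le_sup_right
      rw [hxy] at h0
      exact (hle χ y).trans (le_iSup₂_of_le (χ y) h0 le_rfl)
  intro v hv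
  obtain ⟨a, ha, q, hq, rfl⟩ := Submodule.mem_sup.1 (htop (Submodule.mem_top (x := v)))
  have ha' : a ∈ LieSubalgebra.engel ℂ (y : L) :=
    le_engel_of_isNilpotent inferInstance y.2 ha
  have hq' : q ∈ (LieAlgebra.ad ℂ L (y : L)).maxGenEigenspace 0 := by
    have := (LieSubalgebra.engel ℂ (y : L)).sub_mem hv ha'
    rwa [add_sub_cancel_left] at this
  have h0 : q = 0 := Submodule.disjoint_def.1
    ((LieAlgebra.ad ℂ L (y : L)).independent_maxGenEigenspace 0) q hq' hq
  rwa [h0, add_zero]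

theorem IsLeftNilCartan.le {𝔥 𝔥' : LieSubalgebra ℂ 𝔤} (h : IsLeftNilCartan 𝔥)
    (h' : IsLeftNilCartan 𝔥') : 𝔥 ≤ 𝔥' := by
  obtain ⟨x, hx, rfl⟩ := exists_engel_eq_of_isCartanSubalgebra h.cartan
  obtain ⟨S, hS⟩ := exists_isSemisimplePart (LieAlgebra.ad ℂ 𝔤 x)
  have hmul := hS.map_mul (h.leftNil x hx)
  have hlie : ∀ u v, S ⁅u, v⁆ = ⁅S u, v⁆ + ⁅u, S v⁆ := by
    intro u v
    simp only [lie_eq_mul_sub_mul, map_sub, hmul]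
    abel
  have hinv : ∀ v ∈ 𝔥'.toSubmodule, S v ∈ 𝔥'.toSubmodule := fun v hv =>
    h'.map_mem_of_derivation hmul hv
  obtain ⟨x', hx', hx'e⟩ := exists_engel_eq_of_isCartanSubalgebra h'.cartan
  have := h'.cartan.nilpotent
  have hdec := Submodule.inf_iSup_genEigenspace hinv 1
  have htop : ⨆ μ, S.genEigenspace μ 1 = ⊤ := hS.1.iSup_eigenspace_eq_top
  -- The S-invariant space 𝔥' splits into S-eigenspaces; eigenvalue 0 is separated to write x' = x₀
  -- + x₁.
  rw [htop, inf_top_eq, iSup_split_single _ (0 : ℂ)] at hdec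
  have hx'' : x' ∈ 𝔥'.toSubmodule := hx'
  rw [hdec] at hx''
  obtain ⟨x₀, hx₀, x₁, hx₁, hsum⟩ := Submodule.mem_sup.1 hx''
  have hx₁0 : x₁ ∈ 𝔥'.toSubmodule :=
    (iSup₂_le fun μ _ => inf_le_left : _ ≤ 𝔥'.toSubmodule) hx₁
  have hS0 : S x₀ = 0 := by
    have := Module.End.mem_eigenspace_iff.1 hx₀.2
    simpa using this
  have hx₀x : x₀ ∈ LieSubalgebra.engel ℂ x := hS.pow_apply_eq_of_apply_eq_zero hS0
  -- A sum of ad-nilpotent elements need not be ad-nilpotent; linearity of the weights on 𝔥' gives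
  -- their vanishing at x₁.
  have hχ : ∀ χ : LieModule.Weight ℂ 𝔥' 𝔤, χ ⟨x₁, hx₁0⟩ = 0 := by
    intro χ
    have hle : (⨆ (μ : ℂ) (_ : μ ≠ 0), 𝔥'.toSubmodule ⊓ S.genEigenspace μ 1)
        ≤ (LinearMap.ker χ.toLinear).map 𝔥'.toSubmodule.subtype := by
      refine iSup₂_le fun ν hν u hu => ⟨⟨u, hu.1⟩, ?_, rfl⟩
      change χ ⟨u, hu.1⟩ = 0
      exact weight_apply_eq_zero χ (y := ⟨u, hu.1⟩)
        (mem_engel_of_derivation_apply_eq_smul hS.1 hlie hν (Module.End.mem_eigenspace_iff.1 hu.2))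
    obtain ⟨y, hy, hy'⟩ := hle hx₁
    have : y = ⟨x₁, hx₁0⟩ := Subtype.ext hy'
    rw [← this]
    exact hy
  have hle : LieSubalgebra.engel ℂ x₀ ≤ 𝔥' := by
    refine engel_le_of_forall_weight (x := ⟨x', hx'⟩) (y := ⟨x₀, hx₀.1⟩) hx'e.le fun χ => ?_
    have : (⟨x', hx'⟩ : 𝔥') = ⟨x₀, hx₀.1⟩ + ⟨x₁, hx₁0⟩ := Subtype.ext hsum.symm
    rw [this, map_add, hχ, add_zero]
  exact (le_engel_of_isNilpotent h.cartan.nilpotent hx₀x).trans hle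

theorem IsLeftNilCartan.eq {𝔥 𝔥' : LieSubalgebra ℂ 𝔤} (h : IsLeftNilCartan 𝔥)
    (h' : IsLeftNilCartan 𝔥') : 𝔥 = 𝔥' :=
  le_antisymm (h.le h') (h'.le h)

end ComplexUniqueness

/-! ### Canonical means left nil, over ℂ -/

section Complex

variable {𝔤 : Type*} [LeftPreLieRing 𝔤] [LeftPreLieAlgebra ℂ 𝔤] [FiniteDimensional ℂ 𝔤]

/-- By nilpotency 𝔥 lies in its own zero root space for ad; if this is also the one for L, each x is
killed by a power of L(x). -/
theorem isCanonicalComplex_iff {𝔥 : LieSubalgebra ℂ 𝔤} :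
    IsCanonicalComplex 𝔥 ↔ IsLeftNilCartan 𝔥 := by
  constructor
  · rintro ⟨hc, h⟩
    refine ⟨hc, fun x hx => ?_⟩
    have h0 : x ∈ rootSpace (adRep 𝔥) 0 := by
      refine (Submodule.mem_iInf _).2 fun y => ?_
      exact le_engel_of_isNilpotent hc.nilpotent y.2 hx
    rw [h] at h0
    exact mem_maxGenEigenspace_zero.1 ((Submodule.mem_iInf _).1 h0 ⟨x, hx⟩)
  · intro h
    refine ⟨h.cartan, fun χ => ?_⟩
    exact iInf_congr fun x => maxGenEigenspace_ad_eq (h.leftNil x x.2) (χ x)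

end Complex

/-! ### Real and imaginary parts, and polynomial identities -/

section ComplexVectors

variable {H V : Type*} [AddCommGroup H] [Module ℝ H] [AddCommGroup V] [Module ℝ V]

@[simp]
theorem realPartMap_tmul (c : ℂ) (v : V) : realPartMap V (c ⊗ₜ v) = c.re • v := by
  simp [realPartMap]

theorem realPartMap_baseChange (f : V →ₗ[ℝ] H) (z : ℂ ⊗[ℝ] V) :
    realPartMap H (f.baseChange ℂ z) = f (realPartMap V z) := by
  induction z with
  | zero => simp
  | add x y hx hy => simp only [map_add, hx, hy]
  | tmul c v => simp

theorem eq_tmul_realPartMap (z : ℂ ⊗[ℝ] V) :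
    z = 1 ⊗ₜ realPartMap V z - Complex.I ⊗ₜ realPartMap V (Complex.I • z) := by
  induction z with
  | zero => simp
  | add x y hx hy =>
    simp only [smul_add, map_add, TensorProduct.tmul_add]
    rw [add_sub_add_comm, ← hx, ← hy]
  | tmul c v =>
    rw [TensorProduct.smul_tmul', realPartMap_tmul, realPartMap_tmul, TensorProduct.tmul_smul,
      TensorProduct.tmul_smul, TensorProduct.smul_tmul', TensorProduct.smul_tmul',
      ← TensorProduct.sub_tmul]
    congr 1
    apply Complex.ext <;> simp

theorem eq_zero_of_realPartMap {z : ℂ ⊗[ℝ] V} (h : realPartMap V z = 0)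
    (h' : realPartMap V (Complex.I • z) = 0) : z = 0 := by
  rw [eq_tmul_realPartMap z, h, h']
  simp

theorem tmul_one_eq_zero {v : V} (h : (1 : ℂ) ⊗ₜ[ℝ] v = 0) : v = 0 := by
  have := congrArg (realPartMap V) h
  simpa using this

theorem baseChange_pow_apply (f : Module.End ℝ V) (n : ℕ) (z : ℂ ⊗[ℝ] V) :
    (LinearMap.baseChange ℂ f ^ n) z = LinearMap.baseChange ℂ (f ^ n) z := by
  induction n with
  | zero => simp [Module.End.one_eq_id]
  | succ n ih =>
    rw [pow_succ', Module.End.mul_apply, ih, pow_succ', Module.End.mul_eq_comp,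
      LinearMap.baseChange_comp]
    rfl

theorem mem_range_baseChange_subtype {p : Submodule ℝ V} {z : ℂ ⊗[ℝ] V} :
    z ∈ LinearMap.range (p.subtype.baseChange ℂ)
      ↔ realPartMap V z ∈ p ∧ realPartMap V (Complex.I • z) ∈ p := by
  constructor
  · rintro ⟨w, rfl⟩
    rw [← map_smul, realPartMap_baseChange, realPartMap_baseChange]
    exact ⟨Subtype.property _, Subtype.property _⟩
  · rintro ⟨h1, h2⟩
    refine ⟨1 ⊗ₜ ⟨_, h1⟩ - Complex.I ⊗ₜ ⟨_, h2⟩, ?_⟩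
    rw [map_sub, LinearMap.baseChange_tmul, LinearMap.baseChange_tmul]
    exact (eq_tmul_realPartMap z).symm

theorem mem_maxGenEigenspace_baseChange_zero {f : Module.End ℝ V} {z : ℂ ⊗[ℝ] V} :
    z ∈ Module.End.maxGenEigenspace (LinearMap.baseChange ℂ f) 0
      ↔ realPartMap V z ∈ f.maxGenEigenspace 0
        ∧ realPartMap V (Complex.I • z) ∈ f.maxGenEigenspace 0 := by
  simp only [mem_maxGenEigenspace_zero, baseChange_pow_apply]
  constructor
  · rintro ⟨n, hn⟩
    refine ⟨⟨n, ?_⟩, ⟨n, ?_⟩⟩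
    · rw [← realPartMap_baseChange, hn, map_zero]
    · rw [← realPartMap_baseChange, map_smul, hn, smul_zero, map_zero]
  · rintro ⟨⟨m, hm⟩, ⟨n, hn⟩⟩
    refine ⟨m + n, ?_⟩
    apply eq_zero_of_realPartMap
    · rw [realPartMap_baseChange, add_comm, pow_add, Module.End.mul_apply, hm, map_zero]
    · rw [← map_smul, realPartMap_baseChange, pow_add, Module.End.mul_apply, hn, map_zero]

/-- The left side is a polynomial in s with coefficients from V, of degree at most n + 1: n from the
operator and one from the vector. -/
theorem exists_pow_apply_eq_sum (f g : Module.End ℝ V) (a b : V) (n : ℕ) :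
    ∃ c : ℕ → V, ∀ s : ℂ, ((f.baseChange ℂ + s • g.baseChange ℂ : Module.End ℂ (ℂ ⊗[ℝ] V)) ^ n)
      (1 ⊗ₜ a + s • 1 ⊗ₜ b) = ∑ k ∈ Finset.range (n + 2), s ^ k • ((1 : ℂ) ⊗ₜ[ℝ] c k) := by
  induction n with
  | zero =>
    refine ⟨fun k => if k = 0 then a else b, fun s => ?_⟩
    simp [Finset.sum_range_succ]
  | succ n ih =>
    obtain ⟨c, hc⟩ := ih
    refine ⟨fun k => (if k < n + 2 then f (c k) else 0) + (if k = 0 then 0 else g (c (k - 1))),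
      fun s => ?_⟩
    have e1 : ∑ k ∈ Finset.range (n + 2 + 1),
        s ^ k • ((1 : ℂ) ⊗ₜ[ℝ] (if k < n + 2 then f (c k) else 0))
        = f.baseChange ℂ (∑ k ∈ Finset.range (n + 2), s ^ k • ((1 : ℂ) ⊗ₜ[ℝ] c k)) := by
      rw [Finset.sum_range_succ, if_neg (lt_irrefl _), TensorProduct.tmul_zero, smul_zero, add_zero,
        map_sum]
      refine Finset.sum_congr rfl fun k hk => ?_
      rw [if_pos (Finset.mem_range.1 hk), map_smul, LinearMap.baseChange_tmul]
    have e2 : ∑ k ∈ Finset.range (n + 2 + 1),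
        s ^ k • ((1 : ℂ) ⊗ₜ[ℝ] (if k = 0 then 0 else g (c (k - 1))))
        = s • g.baseChange ℂ (∑ k ∈ Finset.range (n + 2), s ^ k • ((1 : ℂ) ⊗ₜ[ℝ] c k)) := by
      rw [Finset.sum_range_succ', if_pos rfl, TensorProduct.tmul_zero, smul_zero, add_zero,
        map_sum, Finset.smul_sum]
      refine Finset.sum_congr rfl fun k _ => ?_
      rw [if_neg k.succ_ne_zero, map_smul, LinearMap.baseChange_tmul, smul_smul, ← pow_succ',
        Nat.add_sub_cancel]
    rw [pow_succ', Module.End.mul_apply, hc]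
    simp only [TensorProduct.tmul_add, smul_add, Finset.sum_add_distrib]
    rw [LinearMap.add_apply, LinearMap.smul_apply, ← e1, ← e2]

theorem eq_zero_of_forall_sum_pow_smul_eq_zero {N : ℕ} {c : ℕ → V}
    (h : ∀ s : ℝ, ∑ k ∈ Finset.range N, s ^ k • c k = 0) : ∀ k < N, c k = 0 := by
  intro k hk
  rw [← Module.forall_dual_apply_eq_zero_iff (R := ℝ)]
  intro ℓ
  have hp : ∑ k ∈ Finset.range N, Polynomial.C (ℓ (c k)) * Polynomial.X ^ k = 0 := by
    refine Polynomial.funext fun s => ?_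
    have := congrArg ℓ (h s)
    simp only [map_sum, map_smul, smul_eq_mul, map_zero] at this
    simp only [Polynomial.eval_finsetSum, Polynomial.eval_mul, Polynomial.eval_C,
      Polynomial.eval_pow, Polynomial.eval_X, Polynomial.eval_zero, mul_comm (ℓ _), this]
  have := congrArg (fun p => Polynomial.coeff p k) hp
  simpa [Polynomial.finsetSum_coeff, Polynomial.coeff_C_mul, Polynomial.coeff_X_pow, hk]
    using this

theorem pow_baseChange_apply_eq_zero {f g : Module.End ℝ V} {a b : V} {n : ℕ}
    (h : ∀ s : ℝ, ((f + s • g) ^ n) (a + s • b) = 0) (s : ℂ) :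
    ((f.baseChange ℂ + s • g.baseChange ℂ : Module.End ℂ (ℂ ⊗[ℝ] V)) ^ n)
      (1 ⊗ₜ a + s • 1 ⊗ₜ b) = 0 := by
  obtain ⟨c, hc⟩ := exists_pow_apply_eq_sum f g a b n
  have h0 : ∀ k < n + 2, c k = 0 := by
    refine eq_zero_of_forall_sum_pow_smul_eq_zero fun s => ?_
    apply tmul_one_eq_zero
    have h1 := hc (s : ℂ)
    have e1 : (f.baseChange ℂ + (s : ℂ) • g.baseChange ℂ : Module.End ℂ (ℂ ⊗[ℝ] V))
        = (f + s • g).baseChange ℂ := by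
      rw [LinearMap.baseChange_add, LinearMap.baseChange_smul]
      rfl
    have e2 : ((1 : ℂ) ⊗ₜ[ℝ] a + (s : ℂ) • (1 : ℂ) ⊗ₜ[ℝ] b) = 1 ⊗ₜ (a + s • b) := by
      rw [TensorProduct.tmul_add, TensorProduct.tmul_smul]
      rfl
    rw [e1, e2, baseChange_pow_apply, LinearMap.baseChange_tmul, h, TensorProduct.tmul_zero] at h1
    rw [TensorProduct.tmul_sum, h1]
    refine Finset.sum_congr rfl fun k _ => ?_
    rw [TensorProduct.tmul_smul, ← Complex.ofReal_pow]
    rfl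
  rw [hc]
  refine Finset.sum_eq_zero fun k hk => ?_
  rw [h0 k (Finset.mem_range.1 hk), TensorProduct.tmul_zero, smul_zero]

theorem complexify_tmul (ρ : H →ₗ[ℝ] Module.End ℝ V) (c d : ℂ) (x : H) (v : V) :
    complexify ρ (c ⊗ₜ x) (d ⊗ₜ v) = (c * d) ⊗ₜ ρ x v := by
  simp [complexify, TensorProduct.smul_tmul']

theorem complexify_one_tmul (ρ : H →ₗ[ℝ] Module.End ℝ V) (x : H) :
    complexify ρ (1 ⊗ₜ x) = (ρ x).baseChange ℂ := by
  simp [complexify]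

end ComplexVectors

/-! ### Conjugation and real root spaces -/

section Conjugation

variable {H V : Type*} [AddCommGroup H] [Module ℝ H] [AddCommGroup V] [Module ℝ V]

variable (V) in
/-- The complex conjugation of `ℂ ⊗ V`. -/
noncomputable def conjMap : (ℂ ⊗[ℝ] V) →ₗ[ℝ] (ℂ ⊗[ℝ] V) :=
  LinearMap.rTensor V Complex.conjAe.toLinearMap

theorem conjMap_tmul (c : ℂ) (v : V) : conjMap V (c ⊗ₜ v) = (starRingEnd ℂ c) ⊗ₜ v := rfl

theorem conjMap_conjMap (z : ℂ ⊗[ℝ] V) : conjMap V (conjMap V z) = z := by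
  induction z with
  | zero => simp
  | add x y hx hy => simp only [map_add, hx, hy]
  | tmul c v => simp [conjMap_tmul]

theorem conjMap_smul (c : ℂ) (z : ℂ ⊗[ℝ] V) :
    conjMap V (c • z) = starRingEnd ℂ c • conjMap V z := by
  induction z with
  | zero => simp
  | add x y hx hy => simp only [smul_add, map_add, hx, hy]
  | tmul d v => simp [TensorProduct.smul_tmul', conjMap_tmul]

theorem realPartMap_conjMap (z : ℂ ⊗[ℝ] V) : realPartMap V (conjMap V z) = realPartMap V z := by
  induction z with
  | zero => simp
  | add x y hx hy => simp only [map_add, hx, hy]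
  | tmul d v => simp [conjMap_tmul]

theorem one_tmul_realPartMap (z : ℂ ⊗[ℝ] V) :
    1 ⊗ₜ realPartMap V z = (2⁻¹ : ℂ) • (z + conjMap V z) := by
  induction z with
  | zero => simp
  | add x y hx hy =>
    rw [map_add, map_add, TensorProduct.tmul_add, hx, hy, ← smul_add]
    congr 1
    abel
  | tmul d v =>
    rw [conjMap_tmul, ← TensorProduct.add_tmul, TensorProduct.smul_tmul', realPartMap_tmul,
      TensorProduct.tmul_smul, TensorProduct.smul_tmul']
    congr 1
    apply Complex.ext
    · simp only [Complex.smul_re, Complex.one_re, smul_eq_mul, mul_one, Complex.mul_re,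
        Complex.add_re, Complex.conj_re, Complex.inv_re, Complex.re_ofNat, Complex.normSq_ofNat,
        Complex.add_im, Complex.conj_im, add_neg_cancel, mul_zero, sub_zero]
      ring
    · simp

theorem conjMap_complexify (ρ : H →ₗ[ℝ] Module.End ℝ V) (z : ℂ ⊗[ℝ] H) (w : ℂ ⊗[ℝ] V) :
    conjMap V (complexify ρ z w) = complexify ρ (conjMap H z) (conjMap V w) := by
  induction z with
  | zero => simp
  | add x y hx hy => simp only [map_add, LinearMap.add_apply, hx, hy]
  | tmul c x =>
    induction w with
    | zero => simp
    | add x y hx hy => simp only [map_add, hx, hy]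
    | tmul d v => simp [conjMap_tmul, complexify_tmul]

/-- The conjugate of a complex linear functional on `ℂ ⊗ H`. -/
noncomputable def conjDual (χ : Module.Dual ℂ (ℂ ⊗[ℝ] H)) : Module.Dual ℂ (ℂ ⊗[ℝ] H) where
  toFun z := starRingEnd ℂ (χ (conjMap H z))
  map_add' := by simp
  map_smul' := by simp [conjMap_smul]

theorem conjDual_apply (χ : Module.Dual ℂ (ℂ ⊗[ℝ] H)) (z : ℂ ⊗[ℝ] H) :
    conjDual χ z = starRingEnd ℂ (χ (conjMap H z)) := rfl

theorem conjDual_conjDual (χ : Module.Dual ℂ (ℂ ⊗[ℝ] H)) : conjDual (conjDual χ) = χ := by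
  ext z
  simp [conjDual_apply, conjMap_conjMap]

theorem conjMap_mem_rootSpace {ρ : H →ₗ[ℝ] Module.End ℝ V} {χ : Module.Dual ℂ (ℂ ⊗[ℝ] H)}
    {w : ℂ ⊗[ℝ] V} (hw : w ∈ rootSpace (complexify ρ) χ) :
    conjMap V w ∈ rootSpace (complexify ρ) (conjDual χ) := by
  refine (Submodule.mem_iInf _).2 fun z => ?_
  obtain ⟨n, hn⟩ := (Module.End.mem_maxGenEigenspace _ _ _).1
    ((Submodule.mem_iInf _).1 hw (conjMap H z))
  refine (Module.End.mem_maxGenEigenspace _ _ _).2 ⟨n, ?_⟩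
  have key : ∀ n : ℕ, ((complexify ρ z - conjDual χ z • (1 : Module.End ℂ (ℂ ⊗[ℝ] V))) ^ n)
      (conjMap V w) = conjMap V (((complexify ρ (conjMap H z)
        - χ (conjMap H z) • (1 : Module.End ℂ (ℂ ⊗[ℝ] V))) ^ n) w) := by
    intro n
    induction n with
    | zero => rfl
    | succ n ih =>
      rw [pow_succ', Module.End.mul_apply, ih, pow_succ', Module.End.mul_apply]
      simp only [LinearMap.sub_apply, LinearMap.smul_apply, Module.End.one_apply, map_sub,
        conjMap_complexify, conjMap_conjMap, conjMap_smul, conjDual_apply]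
  rw [key, hn, map_zero]

theorem realRootSpace_conjDual (ρ : H →ₗ[ℝ] Module.End ℝ V) (χ : Module.Dual ℂ (ℂ ⊗[ℝ] H)) :
    realRootSpace ρ (conjDual χ) = realRootSpace ρ χ := by
  have h : ∀ χ, realRootSpace ρ χ ≤ realRootSpace ρ (conjDual χ) := by
    rintro χ _ ⟨w, hw, rfl⟩
    exact ⟨conjMap V w, conjMap_mem_rootSpace hw, realPartMap_conjMap w⟩
  refine le_antisymm ?_ (h χ)
  have := h (conjDual χ)
  rwa [conjDual_conjDual] at this

/-- For w in the root space of χ, 1 ⊗ Re w is half the sum of w and its conjugate, so it lies in the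
sum of the root spaces of χ and of its conjugate. Independence then reduces to that of complex root
spaces over conjugation-stable sets of functionals. -/
theorem isDirectSumOf_range_realRootSpace {ρ : H →ₗ[ℝ] Module.End ℝ V}
    (hind : iSupIndep (rootSpace (complexify ρ))) (htop : ⨆ χ, rootSpace (complexify ρ) χ = ⊤) :
    IsDirectSumOf (Set.range (realRootSpace ρ)) := by
  constructor
  · rintro _ ⟨χ, rfl⟩
    rw [Submodule.disjoint_def]
    intro u hu hu'
    -- Distinct functionals can give the same real subspace; I collects all of them, and both I and
    -- its complement are stable under conjugation.
    let I : Set (Module.Dual ℂ (ℂ ⊗[ℝ] H)) := {ψ | realRootSpace ρ ψ = realRootSpace ρ χ}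
    have key : ∀ (J : Set (Module.Dual ℂ (ℂ ⊗[ℝ] H))) ψ, ψ ∈ J → conjDual ψ ∈ J →
        ∀ u ∈ realRootSpace ρ ψ, (1 : ℂ) ⊗ₜ[ℝ] u ∈ ⨆ φ ∈ J, rootSpace (complexify ρ) φ := by
      rintro J ψ hψ hψ' _ ⟨w, hw, rfl⟩
      rw [one_tmul_realPartMap]
      refine Submodule.smul_mem _ _ (Submodule.add_mem _ ?_ ?_)
      · exact Submodule.mem_iSup_of_mem ψ (Submodule.mem_iSup_of_mem hψ hw)
      · exact Submodule.mem_iSup_of_mem _ (Submodule.mem_iSup_of_mem hψ' (conjMap_mem_rootSpace hw))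
    have h1 := key I χ rfl (realRootSpace_conjDual ρ χ) u hu
    have hle : sSup (Set.range (realRootSpace ρ) \ {realRootSpace ρ χ})
        ≤ ((⨆ φ ∈ Iᶜ, rootSpace (complexify ρ) φ).restrictScalars ℝ).comap
          (TensorProduct.mk ℝ ℂ V 1) := by
      refine sSup_le ?_
      rintro _ ⟨⟨ψ, rfl⟩, hne⟩ v hv
      refine key Iᶜ ψ hne ?_ v hv
      change ¬ (realRootSpace ρ (conjDual ψ) = realRootSpace ρ χ)
      rw [realRootSpace_conjDual]
      exact hne
    have h2 : (1 : ℂ) ⊗ₜ[ℝ] u ∈ ⨆ φ ∈ Iᶜ, rootSpace (complexify ρ) φ := hle hu'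
    exact tmul_one_eq_zero
      (Submodule.disjoint_def.1 (hind.disjoint_biSup_biSup disjoint_compl_right) _ h1 h2)
  · rw [sSup_range, eq_top_iff]
    intro v _
    have hle : (⨆ χ, rootSpace (complexify ρ) χ).restrictScalars ℝ
        ≤ (⨆ χ, realRootSpace ρ χ).comap (realPartMap V) := by
      intro z hz
      induction hz using Submodule.iSup_induction' with
      | mem χ w hw => exact Submodule.mem_iSup_of_mem χ ⟨w, hw, rfl⟩
      | zero => simp
      | add x y _ _ hx hy => simpa using Submodule.add_mem _ hx hy
    have h1 : (1 : ℂ) ⊗ₜ[ℝ] v ∈ ⨆ χ, rootSpace (complexify ρ) χ := by rw [htop]; trivial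
    have := hle h1
    simpa using this

end Conjugation

/-! ### Semisimple parts under complexification -/

section SemisimplePart

variable {V : Type*} [AddCommGroup V] [Module ℝ V]

theorem baseChange_injective {f g : Module.End ℝ V}
    (h : (f.baseChange ℂ : Module.End ℂ (ℂ ⊗[ℝ] V)) = g.baseChange ℂ) : f = g := by
  ext v
  have h1 := LinearMap.congr_fun h (1 ⊗ₜ v)
  have h2 := congrArg (realPartMap V) h1
  simpa using h2

theorem isSemisimplePart_baseChange_iff [FiniteDimensional ℝ V] {f S : Module.End ℝ V}
    (hS : S.IsSemisimple) :
    IsSemisimplePart (f.baseChange ℂ : Module.End ℂ (ℂ ⊗[ℝ] V)) (S.baseChange ℂ)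
      ↔ IsSemisimplePart f S := by
  let φ : Module.End ℝ V →ₐ[ℝ] Module.End ℂ (ℂ ⊗[ℝ] V) := Module.End.baseChangeHom ℝ ℂ V
  have hφ : Function.Injective φ := fun f g h => baseChange_injective h
  have h1 : Module.End.IsSemisimple (φ S) := by
    have hsq := hS.minpoly_squarefree
    -- Separability, unlike squarefreeness in general, survives extension of the base field.
    rw [← PerfectField.separable_iff_squarefree] at hsq
    refine Module.End.isSemisimple_of_squarefree_aeval_eq_zero
      (p := (minpoly ℝ S).map (algebraMap ℝ ℂ)) hsq.map.squarefree ?_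
    rw [Polynomial.aeval_map_algebraMap, Polynomial.aeval_algHom_apply, minpoly.aeval, map_zero]
  have h2 : IsNilpotent (φ f - φ S) ↔ IsNilpotent (f - S) := by
    rw [← map_sub, IsNilpotent.map_iff hφ]
  have h3 : Commute (φ f) (φ S) ↔ Commute f S := by
    rw [commute_iff_eq, ← map_mul, ← map_mul, hφ.eq_iff, commute_iff_eq]
  exact ⟨fun h => ⟨hS, h2.1 h.2.1, h3.1 h.2.2⟩, fun h => ⟨h1, h2.2 h.2.1, h3.2 h.2.2⟩⟩

end SemisimplePart

/-! ### Root subspaces as weight spaces of a nilpotent Lie algebra -/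

section WeightSpaces

variable {K H M : Type*} [Field K] [LieRing H] [LieAlgebra K H] [LieRing.IsNilpotent H]
  [AddCommGroup M] [Module K M] [LieRingModule H M] [LieModule K H M]
  {ρ : H →ₗ[K] Module.End K M}

theorem rootSpace_eq_genWeightSpace (hρ : ∀ x, ρ x = LieModule.toEnd K H M x)
    (χ : Module.Dual K H) :
    rootSpace ρ χ = (LieModule.genWeightSpace M (χ : H → K)).toSubmodule := by
  rw [LieModule.genWeightSpace, LieSubmodule.iInf_toSubmodule, rootSpace]
  exact iInf_congr fun x => by rw [hρ]; rfl

theorem iSupIndep_rootSpace (hρ : ∀ x, ρ x = LieModule.toEnd K H M x) :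
    iSupIndep (rootSpace ρ) := by
  have h := (LieSubmodule.iSupIndep_toSubmodule.2
    (LieModule.iSupIndep_genWeightSpace K H M)).comp
    (DFunLike.coe_injective (F := Module.Dual K H))
  rwa [show rootSpace ρ = _ from funext (rootSpace_eq_genWeightSpace hρ)]

theorem iSup_rootSpace_eq_top [CharZero K] [IsAlgClosed K] [FiniteDimensional K M]
    (hρ : ∀ x, ρ x = LieModule.toEnd K H M x) : ⨆ χ, rootSpace ρ χ = ⊤ := by
  have h := congrArg LieSubmodule.toSubmodule (LieModule.iSup_genWeightSpace_eq_top' K H M)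
  rw [LieSubmodule.iSup_toSubmodule, LieSubmodule.top_toSubmodule] at h
  rw [eq_top_iff, ← h]
  refine iSup_le fun χ => ?_
  refine le_trans (le_of_eq ?_) (le_iSup (rootSpace ρ) χ.toLinear)
  rw [rootSpace_eq_genWeightSpace hρ]
  rfl

end WeightSpaces

/-! ### Complexified left-symmetric algebras and the real case -/

section Complexification

variable (𝔤 : Type*) [LeftPreLieRing 𝔤] [LeftPreLieAlgebra ℝ 𝔤]

/-- The complexification of a real left-symmetric algebra. -/
def Complexification : Type _ := ℂ ⊗[ℝ] 𝔤

noncomputable instance : NonUnitalNonAssocRing (Complexification 𝔤) :=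
  inferInstanceAs (NonUnitalNonAssocRing (ℂ ⊗[ℝ] 𝔤))

noncomputable instance : Module ℂ (Complexification 𝔤) :=
  inferInstanceAs (Module ℂ (ℂ ⊗[ℝ] 𝔤))

/-- The underlying space of the complexification is `ℂ ⊗ 𝔤`. -/
noncomputable def toComplexification : (ℂ ⊗[ℝ] 𝔤) ≃ₗ[ℂ] Complexification 𝔤 :=
  LinearEquiv.refl ℂ (ℂ ⊗[ℝ] 𝔤)

variable {𝔤}

theorem toComplexification_tmul_mul (a b : ℂ) (x y : 𝔤) :
    toComplexification 𝔤 (a ⊗ₜ x) * toComplexification 𝔤 (b ⊗ₜ y)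
      = toComplexification 𝔤 ((a * b) ⊗ₜ (x * y)) :=
  Algebra.TensorProduct.tmul_mul_tmul a b x y

@[elab_as_elim]
theorem Complexification.induction {p : Complexification 𝔤 → Prop}
    (tmul : ∀ a x, p (toComplexification 𝔤 (a ⊗ₜ x))) (add : ∀ z w, p z → p w → p (z + w))
    (z : Complexification 𝔤) : p z := by
  obtain ⟨z, rfl⟩ := (toComplexification 𝔤).surjective z
  induction z with
  | zero => simpa using tmul 0 0
  | add x y hx hy => rw [map_add]; exact add _ _ hx hy
  | tmul a x => exact tmul a x

noncomputable instance : LeftPreLieRing (Complexification 𝔤) where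
  assoc_symm' x y z := by
    simp only [associator_apply]
    induction x using Complexification.induction with
    | add x x' h h' =>
      rw [show (x + x') * y * z - (x + x') * (y * z)
        = (x * y * z - x * (y * z)) + (x' * y * z - x' * (y * z)) by simp only [add_mul]; abel,
        h, h']
      simp only [add_mul, mul_add]
      abel
    | tmul a x =>
      induction y using Complexification.induction with
      | add y y' h h' =>
        rw [show (y + y') * toComplexification 𝔤 (a ⊗ₜ x) * z
            - (y + y') * (toComplexification 𝔤 (a ⊗ₜ x) * z)
          = (y * toComplexification 𝔤 (a ⊗ₜ x) * z - y * (toComplexification 𝔤 (a ⊗ₜ x) * z))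
            + (y' * toComplexification 𝔤 (a ⊗ₜ x) * z
              - y' * (toComplexification 𝔤 (a ⊗ₜ x) * z)) by simp only [add_mul]; abel,
          ← h, ← h']
        simp only [add_mul, mul_add]
        abel
      | tmul b y =>
        induction z using Complexification.induction with
        | add z z' h h' =>
          simp only [mul_add]
          rw [add_sub_add_comm, add_sub_add_comm, h, h']
        | tmul c z =>
          have := LeftPreLieRing.assoc_symm x y z
          simp only [associator_apply] at this
          simp only [toComplexification_tmul_mul]
          rw [← map_sub, ← map_sub, mul_assoc, mul_assoc, mul_left_comm b a c,
            ← TensorProduct.tmul_sub, ← TensorProduct.tmul_sub, this]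

noncomputable instance : LeftPreLieAlgebra ℂ (Complexification 𝔤) where
  smul_assoc c x y := by
    simp only [smul_eq_mul]
    induction x using Complexification.induction with
    | add x x' h h' => simp only [smul_add, add_mul, h, h']
    | tmul a x =>
      induction y using Complexification.induction with
      | add y y' h h' => simp only [smul_add, mul_add, h, h']
      | tmul b y =>
        rw [toComplexification_tmul_mul, ← map_smul, ← map_smul, TensorProduct.smul_tmul',
          TensorProduct.smul_tmul', toComplexification_tmul_mul, smul_mul_assoc]
  smul_comm c x y := by
    simp only [smul_eq_mul]
    induction x using Complexification.induction with
    | add x x' h h' => simp only [smul_add, add_mul, h, h']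
    | tmul a x =>
      induction y using Complexification.induction with
      | add y y' h h' => simp only [smul_add, mul_add, h, h']
      | tmul b y =>
        rw [toComplexification_tmul_mul, ← map_smul, ← map_smul, TensorProduct.smul_tmul',
          TensorProduct.smul_tmul', toComplexification_tmul_mul, mul_smul_comm]

instance [FiniteDimensional ℝ 𝔤] : FiniteDimensional ℂ (Complexification 𝔤) :=
  inferInstanceAs (FiniteDimensional ℂ (ℂ ⊗[ℝ] 𝔤))

/-- The inclusion of the complexification of a subalgebra. -/
noncomputable def inclComplexification (𝔥 : LieSubalgebra ℝ 𝔤) :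
    (ℂ ⊗[ℝ] 𝔥) →ₗ[ℂ] Complexification 𝔤 :=
  (toComplexification 𝔤).toLinearMap ∘ₗ 𝔥.toSubmodule.subtype.baseChange ℂ

theorem inclComplexification_tmul (𝔥 : LieSubalgebra ℝ 𝔤) (a : ℂ) (x : 𝔥) :
    inclComplexification 𝔥 (a ⊗ₜ x) = toComplexification 𝔤 (a ⊗ₜ (x : 𝔤)) := rfl

theorem toComplexification_leftRep (𝔥 : LieSubalgebra ℝ 𝔤) (z : ℂ ⊗[ℝ] 𝔥) (w : ℂ ⊗[ℝ] 𝔤) :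
    toComplexification 𝔤 (complexify (leftRep 𝔥) z w)
      = inclComplexification 𝔥 z * toComplexification 𝔤 w := by
  induction z with
  | zero => simp
  | add x y hx hy => simp only [map_add, LinearMap.add_apply, hx, hy, add_mul]
  | tmul a x =>
    induction w with
    | zero => simp
    | add x y hx hy => simp only [map_add, hx, hy, mul_add]
    | tmul b y =>
      rw [complexify_tmul, inclComplexification_tmul, toComplexification_tmul_mul]
      rfl

theorem toComplexification_adRep (𝔥 : LieSubalgebra ℝ 𝔤) (z : ℂ ⊗[ℝ] 𝔥) (w : ℂ ⊗[ℝ] 𝔤) :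
    toComplexification 𝔤 (complexify (adRep 𝔥) z w)
      = ⁅inclComplexification 𝔥 z, toComplexification 𝔤 w⁆ := by
  induction z with
  | zero => simp
  | add x y hx hy => simp only [map_add, LinearMap.add_apply, hx, hy, add_lie]
  | tmul a x =>
    induction w with
    | zero => simp
    | add x y hx hy => simp only [map_add, hx, hy, lie_add]
    | tmul b y =>
      rw [complexify_tmul, lie_eq_mul_sub_mul, inclComplexification_tmul,
        toComplexification_tmul_mul, toComplexification_tmul_mul, mul_comm b a, ← map_sub,
        ← TensorProduct.tmul_sub]
      rfl

theorem mem_maxGenEigenspace_iff_of_intertwine {K V W : Type*} [Field K] [AddCommGroup V]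
    [Module K V] [AddCommGroup W] [Module K W] (e : V ≃ₗ[K] W) {f : Module.End K V}
    {g : Module.End K W} (h : ∀ v, e (f v) = g (e v)) (μ : K) (v : V) :
    v ∈ f.maxGenEigenspace μ ↔ e v ∈ g.maxGenEigenspace μ := by
  have key : ∀ n : ℕ, e (((f - μ • (1 : Module.End K V)) ^ n) v)
      = ((g - μ • (1 : Module.End K W)) ^ n) (e v) := by
    intro n
    induction n with
    | zero => rfl
    | succ n ih =>
      rw [pow_succ', Module.End.mul_apply, pow_succ', Module.End.mul_apply, ← ih]
      simp [h]
  simp only [Module.End.mem_maxGenEigenspace, ← key]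
  simp

theorem mem_maxGenEigenspace_leftRep (𝔥 : LieSubalgebra ℝ 𝔤) (z : ℂ ⊗[ℝ] 𝔥) (μ : ℂ)
    (w : ℂ ⊗[ℝ] 𝔤) : w ∈ (complexify (leftRep 𝔥) z).maxGenEigenspace μ ↔
      toComplexification 𝔤 w ∈ (leftMul ℂ (inclComplexification 𝔥 z)).maxGenEigenspace μ :=
  mem_maxGenEigenspace_iff_of_intertwine _ (toComplexification_leftRep 𝔥 z) μ w

theorem mem_maxGenEigenspace_adRep (𝔥 : LieSubalgebra ℝ 𝔤) (z : ℂ ⊗[ℝ] 𝔥) (μ : ℂ)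
    (w : ℂ ⊗[ℝ] 𝔤) : w ∈ (complexify (adRep 𝔥) z).maxGenEigenspace μ ↔
      toComplexification 𝔤 w
        ∈ (LieAlgebra.ad ℂ _ (inclComplexification 𝔥 z)).maxGenEigenspace μ :=
  mem_maxGenEigenspace_iff_of_intertwine _ (toComplexification_adRep 𝔥 z) μ w

theorem baseChange_subtype_lie (𝔥 : LieSubalgebra ℝ 𝔤) (z w : ℂ ⊗[ℝ] 𝔥) :
    𝔥.toSubmodule.subtype.baseChange ℂ ⁅z, w⁆
      = complexify (adRep 𝔥) z (𝔥.toSubmodule.subtype.baseChange ℂ w) := by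
  induction z with
  | zero => simp
  | add x y hx hy => rw [add_lie, map_add, map_add, LinearMap.add_apply, hx, hy]
  | tmul a x =>
    induction w with
    | zero =>
      rw [map_zero, map_zero]
      exact (congrArg _ (lie_zero (a ⊗ₜ[ℝ] x : ℂ ⊗[ℝ] 𝔥))).trans (map_zero _)
    | add y y' hy hy' =>
      rw [map_add, map_add, ← hy, ← hy', ← map_add]
      exact congrArg _ (lie_add (a ⊗ₜ[ℝ] x : ℂ ⊗[ℝ] 𝔥) y y')
    | tmul b y =>
      rw [LinearMap.baseChange_tmul, complexify_tmul]
      rfl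

/-- The inclusion of the complexification of a subalgebra, as a Lie algebra homomorphism. -/
noncomputable def inclLieHom (𝔥 : LieSubalgebra ℝ 𝔤) : (ℂ ⊗[ℝ] 𝔥) →ₗ⁅ℂ⁆ Complexification 𝔤 :=
  { inclComplexification 𝔥 with
    map_lie' := by
      intro z w
      change inclComplexification 𝔥 ⁅z, w⁆
        = ⁅inclComplexification 𝔥 z, inclComplexification 𝔥 w⁆
      rw [inclComplexification, LinearMap.comp_apply, LinearMap.comp_apply (x := w)]
      refine Eq.trans ?_ (toComplexification_adRep 𝔥 z _)
      exact congrArg (toComplexification 𝔤) (baseChange_subtype_lie 𝔥 z w) }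

/-- The complexification of a subalgebra, inside the complexification of the algebra. -/
noncomputable def complexSubalgebra (𝔥 : LieSubalgebra ℝ 𝔤) :
    LieSubalgebra ℂ (Complexification 𝔤) :=
  (inclLieHom 𝔥).range

theorem inclComplexification_mem (𝔥 : LieSubalgebra ℝ 𝔤) (z : ℂ ⊗[ℝ] 𝔥) :
    inclComplexification 𝔥 z ∈ complexSubalgebra 𝔥 := ⟨z, rfl⟩

theorem mem_complexSubalgebra {𝔥 : LieSubalgebra ℝ 𝔤} {z : ℂ ⊗[ℝ] 𝔤} :
    toComplexification 𝔤 z ∈ complexSubalgebra 𝔥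
      ↔ realPartMap 𝔤 z ∈ 𝔥 ∧ realPartMap 𝔤 (Complex.I • z) ∈ 𝔥 :=
  mem_range_baseChange_subtype (p := 𝔥.toSubmodule)

theorem complexSubalgebra_injective {𝔥 𝔥' : LieSubalgebra ℝ 𝔤}
    (h : complexSubalgebra 𝔥 = complexSubalgebra 𝔥') : 𝔥 = 𝔥' := by
  have key : ∀ (𝔥 : LieSubalgebra ℝ 𝔤) (x : 𝔤),
      x ∈ 𝔥 ↔ toComplexification 𝔤 (1 ⊗ₜ x) ∈ complexSubalgebra 𝔥 := by
    intro 𝔥 x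
    rw [mem_complexSubalgebra, TensorProduct.smul_tmul', realPartMap_tmul, realPartMap_tmul]
    simp
  ext x
  rw [key, key 𝔥', h]

theorem isNilpotent_complexSubalgebra {𝔥 : LieSubalgebra ℝ 𝔤} (h : LieRing.IsNilpotent 𝔥) :
    LieRing.IsNilpotent (complexSubalgebra 𝔥) :=
  LieHom.isNilpotent_range (inclLieHom 𝔥)

theorem leftMul_toComplexification (x : 𝔤) (w : ℂ ⊗[ℝ] 𝔤) :
    toComplexification 𝔤 ((leftMul ℝ x).baseChange ℂ w)
      = leftMul ℂ (toComplexification 𝔤 (1 ⊗ₜ x)) (toComplexification 𝔤 w) := by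
  induction w with
  | zero => simp
  | add x y hx hy => simp only [map_add, hx, hy]
  | tmul b y => simp [toComplexification_tmul_mul]

theorem ad_toComplexification (x : 𝔤) (w : ℂ ⊗[ℝ] 𝔤) :
    toComplexification 𝔤 ((LieAlgebra.ad ℝ 𝔤 x).baseChange ℂ w)
      = LieAlgebra.ad ℂ _ (toComplexification 𝔤 (1 ⊗ₜ x)) (toComplexification 𝔤 w) := by
  induction w with
  | zero => simp
  | add x y hx hy => simp only [map_add, hx, hy]
  | tmul b y =>
    simp [lie_eq_mul_sub_mul, toComplexification_tmul_mul, TensorProduct.tmul_sub]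

theorem complexify_adRep_eq_toEnd (𝔥 : LieSubalgebra ℝ 𝔤) (z : ℂ ⊗[ℝ] 𝔥) :
    complexify (adRep 𝔥) z = LieModule.toEnd ℂ (ℂ ⊗[ℝ] 𝔥) (ℂ ⊗[ℝ] 𝔤) z := by
  induction z with
  | zero => simp
  | add x y hx hy => simp only [map_add, hx, hy]
  | tmul a x =>
    ext w
    simp [complexify_tmul, adRep]
    rfl

variable [FiniteDimensional ℝ 𝔤]

theorem IsLeftNilCartan.complexSubalgebra {𝔥 : LieSubalgebra ℝ 𝔤} (h : IsLeftNilCartan 𝔥) :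
    IsLeftNilCartan (complexSubalgebra 𝔥) := by
  refine ⟨⟨isNilpotent_complexSubalgebra h.cartan.nilpotent, ?_⟩, ?_⟩
  -- The complexification of an Engel subalgebra is the Engel subalgebra of 1 ⊗ x, hence
  -- self-normalizing.
  · obtain ⟨x, -, rfl⟩ := exists_engel_eq_of_isCartanSubalgebra h.cartan
    have : LeftSymmetric.complexSubalgebra (LieSubalgebra.engel ℝ x)
        = LieSubalgebra.engel ℂ (toComplexification 𝔤 (1 ⊗ₜ x)) := by
      ext z
      obtain ⟨z, rfl⟩ := (toComplexification 𝔤).surjective z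
      rw [mem_complexSubalgebra]
      exact (mem_maxGenEigenspace_baseChange_zero (f := LieAlgebra.ad ℝ 𝔤 x)).symm.trans
        (mem_maxGenEigenspace_iff_of_intertwine _ (ad_toComplexification x) 0 z)
    rw [this, LieSubalgebra.normalizer_engel]
  · intro z hz
    obtain ⟨z, rfl⟩ := (toComplexification 𝔤).surjective z
    obtain ⟨ha, hb⟩ := mem_complexSubalgebra.1 hz
    set a := realPartMap 𝔤 z
    set b := realPartMap 𝔤 (Complex.I • z)
    have hz : z = 1 ⊗ₜ a + (-Complex.I) • 1 ⊗ₜ b := by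
      rw [TensorProduct.smul_tmul', smul_eq_mul, mul_one, TensorProduct.neg_tmul, ← sub_eq_add_neg]
      exact eq_tmul_realPartMap z
    -- An exponent independent of s is needed for a polynomial identity in s; the element z is the
    -- value of a + s b at s = -i.
    let N := Module.finrank ℝ 𝔤
    have hs : ∀ s : ℝ, ((leftMul ℝ a + s • leftMul ℝ b) ^ N) (a + s • b) = 0 := by
      intro s
      rw [← map_smul, ← map_add]
      have := mem_maxGenEigenspace_zero.2
        (h.leftNil (a + s • b) (𝔥.add_mem ha (𝔥.smul_mem s hb)))
      rw [Module.End.maxGenEigenspace_eq_genEigenspace_finrank, Module.End.genEigenspace_nat] at this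
      simpa using this
    have h0 := pow_baseChange_apply_eq_zero hs (-Complex.I)
    rw [← hz] at h0
    have hint : ∀ w, toComplexification 𝔤 (((leftMul ℝ a).baseChange ℂ
        + (-Complex.I) • (leftMul ℝ b).baseChange ℂ : Module.End ℂ (ℂ ⊗[ℝ] 𝔤)) w)
        = leftMul ℂ (toComplexification 𝔤 z) (toComplexification 𝔤 w) := by
      intro w
      conv_rhs => rw [hz]
      rw [LinearMap.add_apply, LinearMap.smul_apply, map_add, map_smul,
        leftMul_toComplexification, leftMul_toComplexification]
      simp only [map_add, map_smul, LinearMap.add_apply, LinearMap.smul_apply]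
    exact mem_maxGenEigenspace_zero.1 ((mem_maxGenEigenspace_iff_of_intertwine _ hint 0 z).1
      (mem_maxGenEigenspace_zero.2 ⟨N, h0⟩))

/-- For the forward direction it suffices that x is the real part of some w in the zero root space
of L: L(x) is real, so its generalized null space is closed under real parts. -/
theorem isCanonicalReal_iff {𝔥 : LieSubalgebra ℝ 𝔤} :
    IsCanonicalReal 𝔥 ↔ IsLeftNilCartan 𝔥 := by
  constructor
  · rintro ⟨hc, h⟩
    refine ⟨hc, fun x hx => ?_⟩
    have h0 : (1 : ℂ) ⊗ₜ[ℝ] x ∈ rootSpace (complexify (adRep 𝔥)) 0 := by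
      refine (Submodule.mem_iInf _).2 fun z => (mem_maxGenEigenspace_adRep 𝔥 z _ _).2 ?_
      exact le_engel_of_isNilpotent (isNilpotent_complexSubalgebra hc.nilpotent)
        (inclComplexification_mem 𝔥 z) (inclComplexification_mem 𝔥 (1 ⊗ₜ ⟨x, hx⟩))
    have h1 : x ∈ realRootSpace (adRep 𝔥) 0 := ⟨1 ⊗ₜ x, h0, by simp⟩
    rw [h] at h1
    obtain ⟨w, hw, hwx⟩ := h1
    have h2 := (Submodule.mem_iInf _).1 hw (1 ⊗ₜ ⟨x, hx⟩)
    rw [complexify_one_tmul] at h2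
    have h3 := (mem_maxGenEigenspace_baseChange_zero.1 h2).1
    rw [hwx] at h3
    exact mem_maxGenEigenspace_zero.1 h3
  · intro h
    refine ⟨h.cartan, fun χ => ?_⟩
    have : rootSpace (complexify (adRep 𝔥)) χ = rootSpace (complexify (leftRep 𝔥)) χ := by
      refine iInf_congr fun z => Submodule.ext fun w => ?_
      rw [mem_maxGenEigenspace_adRep, mem_maxGenEigenspace_leftRep,
        maxGenEigenspace_ad_eq (h.complexSubalgebra.leftNil _ (inclComplexification_mem 𝔥 z))]
    rw [realRootSpace, realRootSpace, this]

theorem IsLeftNilCartan.eq_of_real {𝔥 𝔥' : LieSubalgebra ℝ 𝔤} (h : IsLeftNilCartan 𝔥)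
    (h' : IsLeftNilCartan 𝔥') : 𝔥 = 𝔥' :=
  complexSubalgebra_injective (h.complexSubalgebra.eq h'.complexSubalgebra)

theorem IsCanonicalReal.isDirectSumOf {𝔥 : LieSubalgebra ℝ 𝔤} (h : IsCanonicalReal 𝔥) :
    IsDirectSumOf (Set.range (realRootSpace (leftRep 𝔥))) := by
  have := h.1.nilpotent
  rw [show realRootSpace (leftRep 𝔥) = realRootSpace (adRep 𝔥) from
    funext fun χ => (h.2 χ).symm]
  exact isDirectSumOf_range_realRootSpace (iSupIndep_rootSpace (complexify_adRep_eq_toEnd 𝔥))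
    (iSup_rootSpace_eq_top (complexify_adRep_eq_toEnd 𝔥))

theorem IsCanonicalReal.exists_isSemisimplePart {𝔥 : LieSubalgebra ℝ 𝔤} (h : IsCanonicalReal 𝔥)
    (x : 𝔥) : ∃ S : Module.End ℝ 𝔤, IsSemisimplePart (leftRep 𝔥 x) S ∧
      IsSemisimplePart (adRep 𝔥 x) S := by
  obtain ⟨S, hS⟩ := LeftSymmetric.exists_isSemisimplePart (adRep 𝔥 x)
  refine ⟨S, ?_, hS⟩
  have h' := isCanonicalReal_iff.1 h
  have hss := hS.1
  rw [← isSemisimplePart_baseChange_iff hss] at hS ⊢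
  refine hS.of_maxGenEigenspace_eq fun μ => ?_
  rw [← complexify_one_tmul, ← complexify_one_tmul]
  ext w
  rw [mem_maxGenEigenspace_adRep, mem_maxGenEigenspace_leftRep,
    maxGenEigenspace_ad_eq (h'.complexSubalgebra.leftNil _ (inclComplexification_mem 𝔥 _))]

end Complexification

/-! ### Decomposition and semisimple parts over ℂ -/

section Complex

variable {𝔤 : Type*} [LeftPreLieRing 𝔤] [LeftPreLieAlgebra ℂ 𝔤] [FiniteDimensional ℂ 𝔤]

theorem IsCanonicalComplex.isDirectSumOf {𝔥 : LieSubalgebra ℂ 𝔤} (h : IsCanonicalComplex 𝔥) :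
    IsDirectSumOf (Set.range (rootSpace (leftRep 𝔥))) := by
  have := h.1.nilpotent
  rw [show rootSpace (leftRep 𝔥) = rootSpace (adRep 𝔥) from funext fun χ => (h.2 χ).symm]
  have hρ : ∀ x, adRep 𝔥 x = LieModule.toEnd ℂ 𝔥 𝔤 x := fun _ => rfl
  exact ⟨(iSupIndep_rootSpace hρ).sSupIndep_range, by
    rw [sSup_range, iSup_rootSpace_eq_top hρ]⟩

theorem IsCanonicalComplex.exists_isSemisimplePart {𝔥 : LieSubalgebra ℂ 𝔤}
    (h : IsCanonicalComplex 𝔥) (x : 𝔥) : ∃ S : Module.End ℂ 𝔤,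
      IsSemisimplePart (leftRep 𝔥 x) S ∧ IsSemisimplePart (adRep 𝔥 x) S := by
  obtain ⟨S, hS⟩ := LeftSymmetric.exists_isSemisimplePart (adRep 𝔥 x)
  exact ⟨S, hS.of_maxGenEigenspace_eq fun μ =>
    maxGenEigenspace_ad_eq ((isCanonicalComplex_iff.1 h).leftNil x x.2) μ, hS⟩

end Complex

end LeftSymmetric

theorem mainTheorem1 :
    (∀ (𝔤 : Type*) [LeftPreLieRing 𝔤] [LeftPreLieAlgebra ℝ 𝔤] [FiniteDimensional ℝ 𝔤],
      LeftSymmetric.IsComplete ℝ 𝔤 →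
        (∃! 𝔥 : LieSubalgebra ℝ 𝔤, LeftSymmetric.IsCanonicalReal 𝔥) ∧
        ∀ 𝔥 : LieSubalgebra ℝ 𝔤, LeftSymmetric.IsCanonicalReal 𝔥 →
          LeftSymmetric.IsDirectSumOf
            (Set.range (LeftSymmetric.realRootSpace (LeftSymmetric.leftRep 𝔥))) ∧
          ∀ x : 𝔥, ∃ S : Module.End ℝ 𝔤,
            LeftSymmetric.IsSemisimplePart (LeftSymmetric.leftRep 𝔥 x) S ∧
            LeftSymmetric.IsSemisimplePart (LeftSymmetric.adRep 𝔥 x) S) ∧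
    (∀ (𝔤 : Type*) [LeftPreLieRing 𝔤] [LeftPreLieAlgebra ℂ 𝔤] [FiniteDimensional ℂ 𝔤],
      LeftSymmetric.IsComplete ℂ 𝔤 →
        (∃! 𝔥 : LieSubalgebra ℂ 𝔤, LeftSymmetric.IsCanonicalComplex 𝔥) ∧
        ∀ 𝔥 : LieSubalgebra ℂ 𝔤, LeftSymmetric.IsCanonicalComplex 𝔥 →
          LeftSymmetric.IsDirectSumOf
            (Set.range (LeftSymmetric.rootSpace (LeftSymmetric.leftRep 𝔥))) ∧
          ∀ x : 𝔥, ∃ S : Module.End ℂ 𝔤,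
            LeftSymmetric.IsSemisimplePart (LeftSymmetric.leftRep 𝔥 x) S ∧
            LeftSymmetric.IsSemisimplePart (LeftSymmetric.adRep 𝔥 x) S) := by
  constructor
  · intro 𝔤 _ _ _ h
    obtain ⟨𝔥, h𝔥⟩ := h.exists_isLeftNilCartan
    refine ⟨⟨𝔥, LeftSymmetric.isCanonicalReal_iff.2 h𝔥, fun 𝔥' h' => ?_⟩, fun 𝔥' h' =>
      ⟨h'.isDirectSumOf, h'.exists_isSemisimplePart⟩⟩
    exact (LeftSymmetric.isCanonicalReal_iff.1 h').eq_of_real h𝔥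
  · intro 𝔤 _ _ _ h
    obtain ⟨𝔥, h𝔥⟩ := h.exists_isLeftNilCartan
    refine ⟨⟨𝔥, LeftSymmetric.isCanonicalComplex_iff.2 h𝔥, fun 𝔥' h' => ?_⟩, fun 𝔥' h' =>
      ⟨h'.isDirectSumOf, h'.exists_isSemisimplePart⟩⟩
    exact (LeftSymmetric.isCanonicalComplex_iff.1 h').eq h𝔥
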